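/- Let $M$ and $N$ be smooth (Hausdorff, second countable, boundaryless) manifolds; neither connectedness nor orientability is needed. Let $\pi:(M,g_0)\to(N,g_N)$ be a Riemannian submersion: $\pi$ is smooth, $\pi_*$ has rank $\dim N$ everywhere, and $\pi_*$ is isometric on vectors orthogonal to the fibers. Put $\mathcal V=\ker\pi_*$. For a metric $g$ on $M$ with Levi-Civita connection $\nabla$ and $g$-horizontal distribution $\mathcal H=\mathcal V^{\perp_g}$, let $P_{\mathcal H}$ be the $g$-orthogonal projection onto $\mathcal H$; the mean curvature of the fibers is $H=\sum_a P_{\mathcal H}\nabla_{E_a}E_a$ for a local $g$-orthonormal frame $(E_a)$ of $\mathcal V$, and the fibers are minimal if $H=0$. Write $\operatorname{div}_{\mathcal V}X=\sum_a g_0(\nabla^0_{E_a}X,E_a)$, with $(E_a)$ $g_0$-orthonormal and $\nabla^0$ the Levi-Civita connection of $g_0$; for vertical $X$ this is, on each fiber, the divergence of the restriction of $X$ for the metric induced by $g_0$. A variation of $g_0$ is a family of Riemannian metrics $g_t$ on $M$, $t\in(-\epsilon,\epsilon)$, $\epsilon>0$, smooth in $(t,x)$, starting at $g_0$ for $t=0$,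 with $g_t(X,Y)=g_0(X,Y)$ for all vertical $X,Y$; it is non-trivial if $g_t\ne g_0$ for some $t$. A vector field is non-trivial if it is not everywhere zero. All vector fields are smooth. (1) Suppose that $\pi:(M,g_0)\to(N,g_N)$ has minimal fibers. If there is a non-trivial variation $g_t$ of $g_0$ such that $\pi:(M,g_t)\to(N,g_N)$ is a Riemannian submersion with minimal fibers for all $t\in(-\epsilon,\epsilon)$, then there is a non-trivial vertical vector field $\xi$ on $M$ whose restriction to every fiber is divergence-free. (2) Suppose that $\pi:(M,g_0)\to(N,g_N)$ has minimal fibers and $\dim N\ge 1$. If there is a non-trivial vertical vector field $\xi$ on $M$ with $g_0(\xi,\xi)$ bounded, whose restriction to every fiber is divergence-free, then there is, for some $\epsilon>0$, a non-trivial variation $g_t$ of $g_0$ such that $\pi:(M,g_t)\to(N,g_N)$ is a Riemannian submersion with minimal fibers for all $t\in(-\epsilon,\epsilon)$. (3) Let $g_t$ be a variation of $g_0$ such that $\pi:(M,g_t)\to(N,g_N)$ is a Riemannian submersion for all $t\in(-\epsilon,\epsilon)$. Let $H_t$ be the mean curvature of the fibers for $g_t$, let $P^t_{\mathcal H}$ be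 the $g_t$-horizontal projection, let $B_t=\partial_t g_t$, and define $B_t^\sharp$ by $g_t(B_t^\sharp X,Y)=B_t(X,Y)$. Fix $t\in(-\epsilon,\epsilon)$, an open set $U\subset N$, vector fields $W_i$ on $U$ and vertical vector fields $V_i$ on $\pi^{-1}(U)$ (finitely many indices $i$) such that $B_t^\sharp X=\sum_i g_0(V_i,X)\,P^t_{\mathcal H}\pi^*W_i$ for all vertical $X$ on $\pi^{-1}(U)$, where $\pi^*W_i$ is the $g_0$-horizontal lift of $W_i$. Then $H_t$ is differentiable in $t$ at every point of $\pi^{-1}(U)$, and there $$P^t_{\mathcal H}\,\partial_t H_t=\sum_i(\operatorname{div}_{\mathcal V}V_i)\,P^t_{\mathcal H}\pi^*W_i .$$ -/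

import Mathlib

open scoped Manifold ContDiff Topology
open Bundle VectorField

noncomputable section

section OrthonormalBasis

variable {V : Type*} [AddCommGroup V] [Module ℝ V] [FiniteDimensional ℝ V]

theorem exists_formOrthonormalBasis (Q : LinearMap.BilinForm ℝ V)
    (hQ : (∀ u v, Q u v = Q v u) ∧ ∀ v, v ≠ 0 → 0 < Q v v) :
    ∃ e : Module.Basis (Fin (Module.finrank ℝ V)) ℝ V,
      ∀ i j, Q (e i) (e j) = if i = j then 1 else 0 := by
  let c : InnerProductSpace.Core ℝ V :=
    { inner := fun u v => Q u v
      conj_inner_symm := fun u v => hQ.1 v u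
      re_inner_nonneg := fun v => by
        rcases eq_or_ne v 0 with rfl | hv
        · simp
        · exact (hQ.2 v hv).le
      add_left := fun u v w => by simp
      smul_left := fun u v r => by simp
      definite := fun v h => by
        by_contra hv
        exact (hQ.2 v hv).ne' h }
  let : NormedAddCommGroup V := c.toNormedAddCommGroup
  let : InnerProductSpace ℝ V := InnerProductSpace.ofCore c.toCore
  let b := stdOrthonormalBasis ℝ V
  refine ⟨b.toBasis, fun i j => ?_⟩
  have h := orthonormal_iff_ite.mp b.orthonormal i j
  simp only [OrthonormalBasis.coe_toBasis]
  exact h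

/-- A `Q`-orthonormal basis of `V`, for a scalar product `Q` on `V`. -/
def formOrthonormalBasis (Q : LinearMap.BilinForm ℝ V)
    (hQ : (∀ u v, Q u v = Q v u) ∧ ∀ v, v ≠ 0 → 0 < Q v v) :
    Module.Basis (Fin (Module.finrank ℝ V)) ℝ V :=
  Classical.choose (exists_formOrthonormalBasis Q hQ)

theorem formOrthonormalBasis_orthonormal (Q : LinearMap.BilinForm ℝ V)
    (hQ : (∀ u v, Q u v = Q v u) ∧ ∀ v, v ≠ 0 → 0 < Q v v)
    (i j : Fin (Module.finrank ℝ V)) :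
    Q (formOrthonormalBasis Q hQ i) (formOrthonormalBasis Q hQ j) = if i = j then 1 else 0 :=
  Classical.choose_spec (exists_formOrthonormalBasis Q hQ) i j

end OrthonormalBasis

section LeviCivita

variable {E : Type*} [NormedAddCommGroup E] [NormedSpace ℝ E] [FiniteDimensional ℝ E]
  {M : Type*} [TopologicalSpace M] [ChartedSpace E M] [IsManifold 𝓘(ℝ, E) ∞ M]

instance tangentSpaceFiniteDimensional (x : M) : FiniteDimensional ℝ (TangentSpace 𝓘(ℝ, E) x) :=
  inferInstanceAs (FiniteDimensional ℝ E)

instance tangentSpaceT2 (x : M) : T2Space (TangentSpace 𝓘(ℝ, E) x) :=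
  inferInstanceAs (T2Space E)

set_option linter.unusedSectionVars false

variable (E M) in
/-- Smooth Riemannian metrics on the manifold `M`. -/
abbrev SmoothMetric : Type _ :=
  ContMDiffRiemannianMetric 𝓘(ℝ, E) ∞ E (TangentSpace 𝓘(ℝ, E) : M → Type _)

/-- The scalar product `g_x` as a bilinear form on `T_x M`. -/
def metricForm (g : SmoothMetric E M) (x : M) : LinearMap.BilinForm ℝ (TangentSpace 𝓘(ℝ, E) x) :=
  LinearMap.mk₂ ℝ (fun u v => g.inner x u v) (by simp) (by simp) (by simp) (by simp)

theorem metricForm_apply (g : SmoothMetric E M) (x : M) (u v : TangentSpace 𝓘(ℝ, E) x) :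
    metricForm g x u v = g.inner x u v := rfl

theorem metricForm_isRefl (g : SmoothMetric E M) (x : M) : (metricForm g x).IsRefl := by
  intro u v h
  rw [metricForm_apply] at *
  rw [g.symm, h]

theorem metricForm_restrict_nondegenerate (g : SmoothMetric E M) (x : M)
    (p : Submodule ℝ (TangentSpace 𝓘(ℝ, E) x)) : ((metricForm g x).restrict p).Nondegenerate := by
  have key : ∀ u : p, ((metricForm g x).restrict p) u u = 0 → u = 0 := by
    intro u hu
    by_contra h
    exact (g.pos x u (by simpa using h)).ne' hu
  exact ⟨fun u hu => key u (hu u), fun u hu => key u (hu u)⟩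

theorem metricForm_nondegenerate (g : SmoothMetric E M) (x : M) :
    (metricForm g x).Nondegenerate := by
  have key : ∀ u, metricForm g x u u = 0 → u = 0 := by
    intro u hu
    by_contra h
    exact (g.pos x u h).ne' hu
  exact ⟨fun u hu => key u (hu u), fun u hu => key u (hu u)⟩

theorem mdifferentiableAt_metric (g : SmoothMetric E M) {X Y : Π x : M, TangentSpace 𝓘(ℝ, E) x}
    {x : M} (hX : MDiffAt (T% X) x) (hY : MDiffAt (T% Y) x) :
    MDiffAt (fun y => g.inner y (X y) (Y y)) x := by
  have h : MDifferentiableAt 𝓘(ℝ, E) (𝓘(ℝ, E).prod 𝓘(ℝ, ℝ)) (fun m : M ↦ TotalSpace.mk' ℝ (E := Bundle.Trivial M ℝ) m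
      (g.inner m (X m) (Y m))) x := by
    apply MDifferentiableAt.clm_bundle_apply₂ (F₁ := E) (F₂ := E)
    · exact (g.contMDiff x).mdifferentiableAt (by simp)
    · exact hX
    · exact hY
  simp only [mdifferentiableAt_totalSpace] at h
  exact h.2

/-- The Koszul expression, which equals `2 g(∇_X Y, Z)` for the Levi-Civita connection. -/
def koszul (g : SmoothMetric E M) (X Y Z : Π x : M, TangentSpace 𝓘(ℝ, E) x) (x : M) : ℝ :=
  d% (fun y => g.inner y (Y y) (Z y)) x (X x) + d% (fun y => g.inner y (X y) (Z y)) x (Y x)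
    - d% (fun y => g.inner y (X y) (Y y)) x (Z x)
    + g.inner x (mlieBracket 𝓘(ℝ, E) X Y x) (Z x)
    - g.inner x (mlieBracket 𝓘(ℝ, E) X Z x) (Y x)
    - g.inner x (mlieBracket 𝓘(ℝ, E) Y Z x) (X x)

theorem mvfderiv_metric_smul_left (g : SmoothMetric E M) {X Y : Π x : M, TangentSpace 𝓘(ℝ, E) x}
    {f : M → ℝ} {x : M} (hf : MDiffAt f x) (hX : MDiffAt (T% X) x) (hY : MDiffAt (T% Y) x) :
    d% (fun y => g.inner y ((f • X) y) (Y y)) x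
      = f x • d% (fun y => g.inner y (X y) (Y y)) x + g.inner x (X x) (Y x) • d% f x := by
  rw [← mvfderiv_mul hf (mdifferentiableAt_metric g hX hY)]
  congr 1; ext y; simp

theorem mvfderiv_metric_smul_right (g : SmoothMetric E M) {X Y : Π x : M, TangentSpace 𝓘(ℝ, E) x}
    {f : M → ℝ} {x : M} (hf : MDiffAt f x) (hX : MDiffAt (T% X) x) (hY : MDiffAt (T% Y) x) :
    d% (fun y => g.inner y (X y) ((f • Y) y)) x
      = f x • d% (fun y => g.inner y (X y) (Y y)) x + g.inner x (X x) (Y x) • d% f x := by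
  rw [← mvfderiv_mul hf (mdifferentiableAt_metric g hX hY)]
  congr 1; ext y; simp

theorem mvfderiv_metric_add_left (g : SmoothMetric E M) {X X' Y : Π x : M, TangentSpace 𝓘(ℝ, E) x}
    {x : M} (hX : MDiffAt (T% X) x) (hX' : MDiffAt (T% X') x) (hY : MDiffAt (T% Y) x) :
    d% (fun y => g.inner y ((X + X') y) (Y y)) x
      = d% (fun y => g.inner y (X y) (Y y)) x + d% (fun y => g.inner y (X' y) (Y y)) x := by
  rw [← mvfderiv_add (mdifferentiableAt_metric g hX hY) (mdifferentiableAt_metric g hX' hY)]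
  congr 1; ext y; simp

theorem mvfderiv_metric_add_right (g : SmoothMetric E M) {X Y Y' : Π x : M, TangentSpace 𝓘(ℝ, E) x}
    {x : M} (hX : MDiffAt (T% X) x) (hY : MDiffAt (T% Y) x) (hY' : MDiffAt (T% Y') x) :
    d% (fun y => g.inner y (X y) ((Y + Y') y)) x
      = d% (fun y => g.inner y (X y) (Y y)) x + d% (fun y => g.inner y (X y) (Y' y)) x := by
  rw [← mvfderiv_add (mdifferentiableAt_metric g hX hY) (mdifferentiableAt_metric g hX hY')]
  congr 1; ext y; simp

theorem koszul_tensorial_left (g : SmoothMetric E M) {Y Z : Π x : M, TangentSpace 𝓘(ℝ, E) x}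
    {x : M} (hY : MDiffAt (T% Y) x) (hZ : MDiffAt (T% Z) x) :
    TensorialAt 𝓘(ℝ, E) E (fun X => koszul g X Y Z x) x where
  smul hf hX := by
    simp only [koszul, mvfderiv_metric_smul_left g hf hX hZ, mvfderiv_metric_smul_left g hf hX hY,
      mlieBracket_smul_left hf hX]
    simp
    ring
  add hX hX' := by
    simp only [koszul, mvfderiv_metric_add_left g hX hX' hZ, mvfderiv_metric_add_left g hX hX' hY,
      mlieBracket_add_left hX hX']
    simp
    ring

theorem koszul_tensorial_right (g : SmoothMetric E M) {X Y : Π x : M, TangentSpace 𝓘(ℝ, E) x}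
    {x : M} (hX : MDiffAt (T% X) x) (hY : MDiffAt (T% Y) x) :
    TensorialAt 𝓘(ℝ, E) E (fun Z => koszul g X Y Z x) x where
  smul {f Z} hf hZ := by
    simp only [koszul, mvfderiv_metric_smul_right g hf hX hZ,
      mvfderiv_metric_smul_right g hf hY hZ, mlieBracket_smul_right hf hZ]
    simp
    rw [g.symm x (Z _) (Y _), g.symm x (Z _) (X _)]
    ring
  add hZ hZ' := by
    simp only [koszul, mvfderiv_metric_add_right g hX hZ hZ', mvfderiv_metric_add_right g hY hZ hZ',
      mlieBracket_add_right hZ hZ']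
    simp
    ring

theorem koszul_add (g : SmoothMetric E M) {X Y Y' Z : Π x : M, TangentSpace 𝓘(ℝ, E) x}
    {x : M} (hX : MDiffAt (T% X) x) (hY : MDiffAt (T% Y) x) (hY' : MDiffAt (T% Y') x)
    (hZ : MDiffAt (T% Z) x) :
    koszul g X (Y + Y') Z x = koszul g X Y Z x + koszul g X Y' Z x := by
  simp only [koszul, mvfderiv_metric_add_right g hX hY hY', mvfderiv_metric_add_left g hY hY' hZ,
    mlieBracket_add_right hY hY', mlieBracket_add_left hY hY']
  simp
  ring

theorem koszul_smul (g : SmoothMetric E M) {X Y Z : Π x : M, TangentSpace 𝓘(ℝ, E) x} {f : M → ℝ}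
    {x : M} (hf : MDiffAt f x) (hX : MDiffAt (T% X) x) (hY : MDiffAt (T% Y) x)
    (hZ : MDiffAt (T% Z) x) :
    koszul g X (f • Y) Z x = f x * koszul g X Y Z x + 2 * (d% f x (X x) * g.inner x (Y x) (Z x)) := by
  simp only [koszul, mvfderiv_metric_smul_right g hf hX hY, mvfderiv_metric_smul_left g hf hY hZ,
    mlieBracket_smul_right hf hY, mlieBracket_smul_left hf hY]
  simp
  rw [g.symm x (Y _) (X _)]
  ring

/-- For a vector field `Y` differentiable at `x`, the bilinear form `(u, v) ↦ g(∇_u Y, v)` on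
`T_x M`, given by half of the Koszul expression, which is tensorial in `X` and `Z`. -/
def koszulForm (g : SmoothMetric E M) (Y : Π x : M, TangentSpace 𝓘(ℝ, E) x) (x : M)
    (hY : MDiffAt (T% Y) x) :
    TangentSpace 𝓘(ℝ, E) x →L[ℝ] TangentSpace 𝓘(ℝ, E) x →L[ℝ] ℝ :=
  (1 / 2 : ℝ) • TensorialAt.mkHom₂ (I := 𝓘(ℝ, E)) (F := E) (F' := E)
    (fun X Z => koszul g X Y Z x) x
    (fun _ hZ => koszul_tensorial_left g hY hZ) (fun _ hX => koszul_tensorial_right g hX hY)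

theorem koszulForm_apply (g : SmoothMetric E M) {X Y Z : Π x : M, TangentSpace 𝓘(ℝ, E) x} {x : M}
    (hX : MDiffAt (T% X) x) (hY : MDiffAt (T% Y) x) (hZ : MDiffAt (T% Z) x) :
    koszulForm g Y x hY (X x) (Z x) = (1 / 2) * koszul g X Y Z x := by
  simp only [koszulForm, smul_apply, smul_eq_mul]
  rw [TensorialAt.mkHom₂_apply _ _ hX hZ]

/-- The vector `u ∈ T_x M` with `g(u, v) = φ(v)` for all `v`. -/
def sharp (g : SmoothMetric E M) (x : M) :
    (TangentSpace 𝓘(ℝ, E) x →L[ℝ] ℝ) →ₗ[ℝ] TangentSpace 𝓘(ℝ, E) x :=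
  ((metricForm g x).toDual (metricForm_nondegenerate g x)).symm.toLinearMap ∘ₗ
    ContinuousLinearMap.coeLM ℝ

theorem inner_sharp (g : SmoothMetric E M) (x : M) (φ : TangentSpace 𝓘(ℝ, E) x →L[ℝ] ℝ)
    (v : TangentSpace 𝓘(ℝ, E) x) : g.inner x (sharp g x φ) v = φ v :=
  LinearMap.BilinForm.apply_toDual_symm_apply (hB := metricForm_nondegenerate g x)
    (φ : TangentSpace 𝓘(ℝ, E) x →ₗ[ℝ] ℝ) v

theorem ext_inner (g : SmoothMetric E M) (x : M) {u u' : TangentSpace 𝓘(ℝ, E) x}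
    (h : ∀ v, g.inner x u v = g.inner x u' v) : u = u' := by
  by_contra hne
  have h1 := g.pos x (u - u') (sub_ne_zero.mpr hne)
  have h2 := h (u - u')
  simp only [map_sub, sub_apply] at h1 h2
  linarith

open Classical in
/-- The operator `Y ↦ (x ↦ (u ↦ ∇_u Y))` of the Levi-Civita connection (with value `0` at points
where `Y` is not differentiable). -/
def leviCivitaFun (g : SmoothMetric E M) (Y : Π x : M, TangentSpace 𝓘(ℝ, E) x) (x : M) :
    TangentSpace 𝓘(ℝ, E) x →L[ℝ] TangentSpace 𝓘(ℝ, E) x :=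
  if hY : MDiffAt (T% Y) x then
    LinearMap.toContinuousLinearMap (sharp g x ∘ₗ (koszulForm g Y x hY).toLinearMap)
  else 0

/-- The Koszul formula. -/
theorem inner_leviCivitaFun (g : SmoothMetric E M) {X Y Z : Π x : M, TangentSpace 𝓘(ℝ, E) x}
    {x : M} (hX : MDiffAt (T% X) x) (hY : MDiffAt (T% Y) x) (hZ : MDiffAt (T% Z) x) :
    g.inner x (leviCivitaFun g Y x (X x)) (Z x) = (1 / 2) * koszul g X Y Z x := by
  rw [← koszulForm_apply g hX hY hZ, leviCivitaFun, dif_pos hY]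
  exact inner_sharp g x _ _

/-- The Levi-Civita connection of `g`; `leviCivita g Y x (X x)` is `(∇_X Y)(x)`. -/
def leviCivita (g : SmoothMetric E M) :
    CovariantDerivative 𝓘(ℝ, E) E (TangentSpace 𝓘(ℝ, E) : M → Type _) where
  toFun := leviCivitaFun g
  isCovariantDerivativeOnUniv :=
    { add := by
        intro Y Y' x hY hY' _
        ext1 u
        refine ext_inner g x fun v => ?_
        have hu := FiberBundle.mdifferentiableAt_extend 𝓘(ℝ, E) E (V := (TangentSpace 𝓘(ℝ, E) : M → Type _)) u
        have hv := FiberBundle.mdifferentiableAt_extend 𝓘(ℝ, E) E (V := (TangentSpace 𝓘(ℝ, E) : M → Type _)) v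
        have h := inner_leviCivitaFun g hu (mdifferentiableAt_add_section hY hY') hv
        have h1 := inner_leviCivitaFun g hu hY hv
        have h2 := inner_leviCivitaFun g hu hY' hv
        rw [koszul_add g hu hY hY' hv] at h
        simp only [FiberBundle.extend_apply_self] at h h1 h2
        simp only [add_apply, map_add, h, h1, h2]
        ring
      leibniz := by
        intro Y f x hY hf _
        ext1 u
        refine ext_inner g x fun v => ?_
        have hu := FiberBundle.mdifferentiableAt_extend 𝓘(ℝ, E) E (V := (TangentSpace 𝓘(ℝ, E) : M → Type _)) u
        have hv := FiberBundle.mdifferentiableAt_extend 𝓘(ℝ, E) E (V := (TangentSpace 𝓘(ℝ, E) : M → Type _)) v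
        have h := inner_leviCivitaFun g hu (hf.smul_section hY) hv
        have h1 := inner_leviCivitaFun g hu hY hv
        have h2 := koszul_smul g hf hu hY hv
        simp only [FiberBundle.extend_apply_self] at h h1 h2
        rw [h2] at h
        simp only [add_apply, map_add, smul_apply, map_smul, ContinuousLinearMap.smulRight_apply,
          smul_eq_mul, h, h1]
        ring }

/-- The Levi-Civita connection is compatible with the metric. -/
theorem leviCivita_metric (g : SmoothMetric E M) {X Y Z : Π x : M, TangentSpace 𝓘(ℝ, E) x}
    {x : M} (hX : MDiffAt (T% X) x) (hY : MDiffAt (T% Y) x) (hZ : MDiffAt (T% Z) x) :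
    d% (fun y => g.inner y (Y y) (Z y)) x (X x)
      = g.inner x (leviCivita g Y x (X x)) (Z x) + g.inner x (Y x) (leviCivita g Z x (X x)) := by
  have h1 := inner_leviCivitaFun g hX hY hZ
  have h2 := inner_leviCivitaFun g hX hZ hY
  have h3 : (fun y => g.inner y (Z y) (Y y)) = fun y => g.inner y (Y y) (Z y) :=
    funext fun y => g.symm y _ _
  rw [g.symm x (Y x)]
  change _ = g.inner x (leviCivitaFun g Y x (X x)) (Z x) +
    g.inner x (leviCivitaFun g Z x (X x)) (Y x)
  rw [h1, h2, koszul, koszul, h3, mlieBracket_swap_apply (V := Z)]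
  simp only [map_neg, neg_apply]
  ring

/-- The Levi-Civita connection is torsion-free. -/
theorem leviCivita_torsion (g : SmoothMetric E M) : (leviCivita g).torsion = 0 := by
  rw [CovariantDerivative.torsion_eq_zero_iff]
  intro X Y x hX hY
  refine ext_inner g x fun v => ?_
  have hv := FiberBundle.mdifferentiableAt_extend 𝓘(ℝ, E) E
    (V := (TangentSpace 𝓘(ℝ, E) : M → Type _)) v
  have h1 := inner_leviCivitaFun g hX hY hv
  have h2 := inner_leviCivitaFun g hY hX hv
  have h3 : (fun y => g.inner y (X y) (Y y)) = fun y => g.inner y (Y y) (X y) :=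
    funext fun y => g.symm y _ _
  rw [koszul, mlieBracket_swap_apply (V := X) (W := Y), h3] at h1
  rw [koszul] at h2
  rw [mlieBracket_swap_apply (V := X) (W := Y)]
  simp only [FiberBundle.extend_apply_self] at h1 h2
  simp only [map_sub, sub_apply, map_neg, neg_apply] at h1 h2 ⊢
  change g.inner x (leviCivitaFun g Y x (X x)) v - g.inner x (leviCivitaFun g X x (Y x)) v = _
  rw [h1, h2]
  ring

end LeviCivita

section Submersion

variable {E : Type*} [NormedAddCommGroup E] [NormedSpace ℝ E] [FiniteDimensional ℝ E]
  {M : Type*} [TopologicalSpace M] [ChartedSpace E M] [IsManifold 𝓘(ℝ, E) ∞ M]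
  {F : Type*} [NormedAddCommGroup F] [NormedSpace ℝ F] [FiniteDimensional ℝ F]
  {N : Type*} [TopologicalSpace N] [ChartedSpace F N] [IsManifold 𝓘(ℝ, F) ∞ N]

/-- The vertical space `ker (pr_*)_x ⊆ T_x M`. -/
def verticalSpace (pr : M → N) (x : M) : Submodule ℝ (TangentSpace 𝓘(ℝ, E) x) :=
  LinearMap.ker (mfderiv 𝓘(ℝ, E) 𝓘(ℝ, F) pr x).toLinearMap

/-- The `g`-horizontal space, i.e. the `g`-orthogonal complement of the vertical space. -/
def horizontalSpace (g : SmoothMetric E M) (pr : M → N) (x : M) :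
    Submodule ℝ (TangentSpace 𝓘(ℝ, E) x) :=
  (metricForm g x).orthogonal (verticalSpace (E := E) (F := F) pr x)

theorem isCompl_vertical_horizontal (g : SmoothMetric E M) (pr : M → N) (x : M) :
    IsCompl (verticalSpace (E := E) (F := F) pr x) (horizontalSpace (F := F) g pr x) :=
  LinearMap.BilinForm.isCompl_orthogonal_of_restrict_nondegenerate (metricForm_isRefl g x)
    (metricForm_restrict_nondegenerate g x _)

/-- The `g`-orthogonal projection of `T_x M` onto the vertical space. -/
def verticalProj (g : SmoothMetric E M) (pr : M → N) (x : M) :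
    TangentSpace 𝓘(ℝ, E) x →ₗ[ℝ] TangentSpace 𝓘(ℝ, E) x :=
  Submodule.projection _ _ (isCompl_vertical_horizontal (F := F) g pr x)

/-- The `g`-orthogonal projection of `T_x M` onto the `g`-horizontal space. -/
def horizontalProj (g : SmoothMetric E M) (pr : M → N) (x : M) :
    TangentSpace 𝓘(ℝ, E) x →ₗ[ℝ] TangentSpace 𝓘(ℝ, E) x :=
  Submodule.projection _ _ (isCompl_vertical_horizontal (F := F) g pr x).symm

/-- `pr : (M, g) → (N, gN)` is a Riemannian submersion: `pr` is smooth, `pr_*` has rank `dim N`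
everywhere, and `pr_*` is isometric on the vectors orthogonal to the fibers. -/
structure IsRiemannianSubmersion (pr : M → N) (g : SmoothMetric E M) (gN : SmoothMetric F N) :
    Prop where
  contMDiff : ContMDiff 𝓘(ℝ, E) 𝓘(ℝ, F) ∞ pr
  surjective : ∀ x, Function.Surjective (mfderiv 𝓘(ℝ, E) 𝓘(ℝ, F) pr x)
  isometry : ∀ x, ∀ u ∈ horizontalSpace (F := F) g pr x, ∀ v ∈ horizontalSpace (F := F) g pr x,
    g.inner x u v =
      gN.inner (pr x) (mfderiv 𝓘(ℝ, E) 𝓘(ℝ, F) pr x u) (mfderiv 𝓘(ℝ, E) 𝓘(ℝ, F) pr x v)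

/-- The `g`-horizontal lift to `x` of a vector `w ∈ T_{pr x} N` in the range of `(pr_*)_x`, as the
`g`-horizontal part of any vector that `pr_*` maps to `w`. -/
def horizontalLift (g : SmoothMetric E M) (pr : M → N) (x : M) (w : TangentSpace 𝓘(ℝ, F) (pr x)) :
    TangentSpace 𝓘(ℝ, E) x :=
  horizontalProj (F := F) g pr x (Function.invFun (mfderiv 𝓘(ℝ, E) 𝓘(ℝ, F) pr x) w)

/-- The scalar product that `g` induces on the vertical space (the tangent space of the fiber). -/
def verticalForm (g : SmoothMetric E M) (pr : M → N) (x : M) :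
    LinearMap.BilinForm ℝ (verticalSpace (E := E) (F := F) pr x) :=
  (metricForm g x).restrict (verticalSpace (E := E) (F := F) pr x)

theorem verticalForm_isScalarProduct (g : SmoothMetric E M) (pr : M → N) (x : M) :
    (∀ u v, verticalForm (F := F) g pr x u v = verticalForm (F := F) g pr x v u) ∧
      ∀ v, v ≠ 0 → 0 < verticalForm (F := F) g pr x v v :=
  ⟨fun u v => g.symm x u v, fun v hv => g.pos x v (by simpa using hv)⟩

/-- A `g`-orthonormal basis `E_1, …, E_n` of the vertical space at `x`. -/
def verticalBasis (g : SmoothMetric E M) (pr : M → N) (x : M) :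
    Module.Basis (Fin (Module.finrank ℝ (verticalSpace (E := E) (F := F) pr x))) ℝ
      (verticalSpace (E := E) (F := F) pr x) :=
  formOrthonormalBasis (verticalForm (F := F) g pr x) (verticalForm_isScalarProduct g pr x)

/-- A vertical vector field, smooth near `x`, which extends a vertical vector `v` at `x`. -/
def verticalExtend (g : SmoothMetric E M) (pr : M → N) {x : M} (v : TangentSpace 𝓘(ℝ, E) x) (y : M) :
    TangentSpace 𝓘(ℝ, E) y :=
  verticalProj (F := F) g pr y
    (FiberBundle.extend E (E := (TangentSpace 𝓘(ℝ, E) : M → Type _)) v y)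

/-- The second fundamental form of the fibers, `h(u, v) = P_H (∇_u Y)(x)` for vertical vectors
`u`, `v` at `x`, where `Y` is a vertical field with `Y x = v` (`h` is a tensor: the choice of
the vertical extension `Y` is immaterial). -/
def secondFundamentalForm (g : SmoothMetric E M) (pr : M → N) (x : M)
    (u v : TangentSpace 𝓘(ℝ, E) x) : TangentSpace 𝓘(ℝ, E) x :=
  horizontalProj (F := F) g pr x (leviCivita g (verticalExtend (F := F) g pr v) x u)

/-- The mean curvature `H = ∑ₐ h(Eₐ, Eₐ)` of the fibers. -/
def meanCurvature (g : SmoothMetric E M) (pr : M → N) (x : M) : TangentSpace 𝓘(ℝ, E) x :=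
  ∑ a, secondFundamentalForm (F := F) g pr x (verticalBasis (F := F) g pr x a)
    (verticalBasis (F := F) g pr x a)

/-- The fibers of `pr : (M, g) → N` are minimal. -/
def HasMinimalFibers (g : SmoothMetric E M) (pr : M → N) : Prop :=
  ∀ x, meanCurvature (F := F) g pr x = 0

/-- The vertical divergence `div_V X = ∑ₐ g(∇_{Eₐ} X, Eₐ)` of a vector field `X` on `M`. If `X` is
vertical, this is at each point the divergence of the restriction of `X` to the fiber. -/
def verticalDiv (g : SmoothMetric E M) (pr : M → N) (X : Π x : M, TangentSpace 𝓘(ℝ, E) x) (x : M) :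
    ℝ :=
  ∑ a, g.inner x (leviCivita g X x (verticalBasis (F := F) g pr x a))
    (verticalBasis (F := F) g pr x a)

/-- `{g_t, t ∈ (-ε, ε)}` is a variation of `g₀` in `Riem(M, V, g₀)`: a family of metrics which is
smooth in `(t, x)`, starts at `g₀` and agrees with `g₀` on vertical vectors. The values `g t` for
`t ∉ (-ε, ε)` are irrelevant. -/
structure IsVariation (pr : M → N) (g₀ : SmoothMetric E M) (ε : ℝ) (g : ℝ → SmoothMetric E M) :
    Prop where
  pos : 0 < ε
  zero : g 0 = g₀
  smooth : ContMDiffOn (𝓘(ℝ, ℝ).prod 𝓘(ℝ, E)) (𝓘(ℝ, E).prod 𝓘(ℝ, E →L[ℝ] E →L[ℝ] ℝ)) ∞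
    (fun p : ℝ × M => TotalSpace.mk' (E →L[ℝ] E →L[ℝ] ℝ)
      (E := fun x : M => TangentSpace 𝓘(ℝ, E) x →L[ℝ] TangentSpace 𝓘(ℝ, E) x →L[ℝ] ℝ)
      p.2 ((g p.1).inner p.2))
    (Set.Ioo (-ε) ε ×ˢ Set.univ)
  vertical : ∀ t ∈ Set.Ioo (-ε) ε, ∀ x, ∀ u ∈ verticalSpace (E := E) (F := F) pr x,
    ∀ v ∈ verticalSpace (E := E) (F := F) pr x, (g t).inner x u v = g₀.inner x u v

/-- The tensor `B_t = ∂_t g_t`. -/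
def metricVelocity (g : ℝ → SmoothMetric E M) (t : ℝ) (x : M) (u v : TangentSpace 𝓘(ℝ, E) x) : ℝ :=
  deriv (fun s => (g s).inner x u v) t

/-- `B_t^♯ u = w`, where `B_t^♯` is given by `g_t(B_t^♯ u, v) = B_t(u, v)` for all `v`. -/
def IsVelocitySharp (g : ℝ → SmoothMetric E M) (t : ℝ) (x : M) (u w : TangentSpace 𝓘(ℝ, E) x) :
    Prop :=
  ∀ v, (g t).inner x w v = metricVelocity g t x u v

end Submersion
end

/-! A submersion metric over $(N,g_N)$ with prescribed restriction to the fibers is determined by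
its horizontal lifts (`IsRiemannianSubmersion.eq_of_horizontalLift_eq`), and the lifts $LW$, $L'W$
of a field $W$ for two such metrics $g$, $g'$ differ by a vertical field. The proof measures how the
mean curvature sees this difference.

Differentiating the orthogonality of vertical and horizontal fields gives
$g(H,LW)=-\operatorname{div}_{\mathcal V}(LW)$ (`IsRiemannianSubmersion.inner_meanCurvature`). By
the Koszul formula, $g(\nabla_YX,Y)=\frac12X(g(Y,Y))+g([Y,X],Y)$; if $Y$ is vertical and $X$ is
projectable, then $[Y,X]$ is vertical, so $\operatorname{div}_{\mathcal V}X$ depends only on the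
metric of the fibers (`IsRiemannianSubmersion.verticalDiv_congr`). Hence
$g'(H',L'W)=g(H,LW)-\operatorname{div}_{\mathcal V}(L'W-LW)$.

(1) If both metrics have minimal fibers, $L'W-LW$ is divergence-free along the fibers, and it is
non-zero for some $W$ if $g'\ne g$.

(2) Conversely, pull $g_0$ back under the shear $u\mapsto u-t\,g_0(Z,u)\,\xi$, where $Z$ is the lift
of a field $Q$ on $N$. The shear is invertible because $Z\perp\xi$. It changes the lift of $W$ by
$t\,(g_N(Q,W)\circ\pi)\,\xi$; the coefficient is constant along the fibers, so this change has zero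
divergence and minimality persists.

(3) The hypothesis on $B_t^\sharp$ says that the lift of $W$ moves with velocity $-\sum_i
g_N(W_i,W)V_i$. So $g_t(H_t,L_tW)$ has derivative $\sum_i g_N(W_i,W)\operatorname{div}_{\mathcal
V}V_i$, once the derivative in $t$ is exchanged with one along the fiber. Expand $H_t$ in the lifts
of a $g_N$-orthonormal basis: the derivatives of the lifts are vertical and disappear under
$P^t_{\mathcal H}$. -/

noncomputable section

set_option linter.unusedSectionVars false

section SmoothnessExponents

theorem two_le_infty : (2 : WithTop ℕ∞) ≤ ∞ := ENat.LEInfty.out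

theorem one_add_one_le_infty : (1 + 1 : WithTop ℕ∞) ≤ ∞ := by
  rw [one_add_one_eq_two]; exact two_le_infty

theorem one_le_infty : (1 : WithTop ℕ∞) ≤ ∞ := ENat.LEInfty.out

end SmoothnessExponents

/-! ### Differentials and Lie brackets read in a chart -/

section ChartCalculus

variable {E : Type*} [NormedAddCommGroup E] [NormedSpace ℝ E]
  {M : Type*} [TopologicalSpace M] [ChartedSpace E M]
  {G : Type*} [NormedAddCommGroup G] [NormedSpace ℝ G]

theorem Filter.EventuallyEq.mvfderiv_eq {f f' : M → G} {x : M} (h : f =ᶠ[𝓝 x] f') :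
    mvfderiv 𝓘(ℝ, E) f x = mvfderiv 𝓘(ℝ, E) f' x := by
  have h1 := h.mfderiv_eq (I := 𝓘(ℝ, E)) (I' := 𝓘(ℝ, G))
  ext v
  exact congrArg (fun L : E →L[ℝ] G => L v) h1

variable [IsManifold 𝓘(ℝ, E) ∞ M]

theorem mvfderiv_comp_extChartAt {q : E → G} {x y : M}
    (hy : y ∈ (extChartAt 𝓘(ℝ, E) x).source)
    (hq : DifferentiableAt ℝ q (extChartAt 𝓘(ℝ, E) x y)) (v : TangentSpace 𝓘(ℝ, E) y) :
    mvfderiv 𝓘(ℝ, E) (q ∘ extChartAt 𝓘(ℝ, E) x) y v =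
      fderiv ℝ q (extChartAt 𝓘(ℝ, E) x y) (mfderiv 𝓘(ℝ, E) 𝓘(ℝ, E) (extChartAt 𝓘(ℝ, E) x) y v) := by
  have h := mfderiv_comp (I := 𝓘(ℝ, E)) (I' := 𝓘(ℝ, E)) (I'' := 𝓘(ℝ, G)) y (g := q)
    hq.mdifferentiableAt (mdifferentiableAt_extChartAt (by simpa using hy))
  rw [mfderiv_eq_fderiv] at h
  exact congrArg (fun L : E →L[ℝ] G => L v) h

theorem contMDiffAt_extChartAt_symm_of_mem {x y : M} (hy : y ∈ (extChartAt 𝓘(ℝ, E) x).source) :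
    ContMDiffAt 𝓘(ℝ, E) 𝓘(ℝ, E) ∞ (extChartAt 𝓘(ℝ, E) x).symm (extChartAt 𝓘(ℝ, E) x y) :=
  (contMDiffOn_extChartAt_symm x).contMDiffAt
    (extChartAt_target_mem_nhds' ((extChartAt 𝓘(ℝ, E) x).map_source hy))

theorem comp_extChartAt_symm_comp_eventuallyEq (f : M → G) {x y : M}
    (hy : y ∈ (extChartAt 𝓘(ℝ, E) x).source) :
    f =ᶠ[𝓝 y] (f ∘ (extChartAt 𝓘(ℝ, E) x).symm) ∘ extChartAt 𝓘(ℝ, E) x := by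
  filter_upwards [extChartAt_source_mem_nhds' hy] with z hz
  simp only [Function.comp_apply, (extChartAt 𝓘(ℝ, E) x).left_inv hz]

theorem ContMDiffAt.contDiffAt_comp_extChartAt_symm {f : M → G} {x y : M} {n : ℕ∞}
    (hy : y ∈ (extChartAt 𝓘(ℝ, E) x).source) (hf : ContMDiffAt 𝓘(ℝ, E) 𝓘(ℝ, G) n f y) :
    ContDiffAt ℝ n (f ∘ (extChartAt 𝓘(ℝ, E) x).symm) (extChartAt 𝓘(ℝ, E) x y) := by
  rw [← contMDiffAt_iff_contDiffAt]
  refine ContMDiffAt.comp_of_eq (y := y) hf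
    ((contMDiffAt_extChartAt_symm_of_mem hy).of_le (by exact_mod_cast le_top)) ?_
  exact (extChartAt 𝓘(ℝ, E) x).left_inv hy

theorem MDifferentiableAt.differentiableAt_comp_extChartAt_symm {f : M → G} {x y : M}
    (hy : y ∈ (extChartAt 𝓘(ℝ, E) x).source) (hf : MDifferentiableAt 𝓘(ℝ, E) 𝓘(ℝ, G) f y) :
    DifferentiableAt ℝ (f ∘ (extChartAt 𝓘(ℝ, E) x).symm) (extChartAt 𝓘(ℝ, E) x y) := by
  rw [← mdifferentiableAt_iff_differentiableAt]
  have hf' : MDifferentiableAt 𝓘(ℝ, E) 𝓘(ℝ, G) f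
      ((extChartAt 𝓘(ℝ, E) x).symm (extChartAt 𝓘(ℝ, E) x y)) := by
    rwa [(extChartAt 𝓘(ℝ, E) x).left_inv hy]
  exact hf'.comp _ ((contMDiffAt_extChartAt_symm_of_mem hy).mdifferentiableAt (by simp))

/-- The differential of a function read in a chart. -/
theorem mvfderiv_eq_fderiv_extChartAt {f : M → G} {x y : M}
    (hy : y ∈ (extChartAt 𝓘(ℝ, E) x).source) (hf : MDifferentiableAt 𝓘(ℝ, E) 𝓘(ℝ, G) f y)
    (v : TangentSpace 𝓘(ℝ, E) y) :
    mvfderiv 𝓘(ℝ, E) f y v =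
      fderiv ℝ (f ∘ (extChartAt 𝓘(ℝ, E) x).symm) (extChartAt 𝓘(ℝ, E) x y)
        (mfderiv 𝓘(ℝ, E) 𝓘(ℝ, E) (extChartAt 𝓘(ℝ, E) x) y v) := by
  rw [(comp_extChartAt_symm_comp_eventuallyEq f hy).mvfderiv_eq,
    mvfderiv_comp_extChartAt hy (hf.differentiableAt_comp_extChartAt_symm hy)]

/-- A vector field read in the chart at `x`. -/
def chartField (X : Π x : M, TangentSpace 𝓘(ℝ, E) x) (x : M) : E → E :=
  mpullbackWithin 𝓘(ℝ, E) 𝓘(ℝ, E) (extChartAt 𝓘(ℝ, E) x).symm X (Set.range 𝓘(ℝ, E))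

/-- Pulling back along the inverse chart applies the inverse of its differential, which is the
differential of the chart. -/
theorem chartField_extChartAt (X : Π x : M, TangentSpace 𝓘(ℝ, E) x) {x y : M}
    (hy : y ∈ (extChartAt 𝓘(ℝ, E) x).source) :
    chartField X x (extChartAt 𝓘(ℝ, E) x y) =
      mfderiv 𝓘(ℝ, E) 𝓘(ℝ, E) (extChartAt 𝓘(ℝ, E) x) y (X y) := by
  have h := isInvertible_mfderiv_extChartAt (I := 𝓘(ℝ, E)) hy
  have h2 := mfderivWithin_extChartAt_symm_comp_mfderiv_extChartAt' (I := 𝓘(ℝ, E)) hy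
  have h3 := isInvertible_mfderivWithin_extChartAt_symm (I := 𝓘(ℝ, E))
    ((extChartAt 𝓘(ℝ, E) x).map_source hy)
  have hl : (extChartAt 𝓘(ℝ, E) x).symm (extChartAt 𝓘(ℝ, E) x y) = y :=
    (extChartAt 𝓘(ℝ, E) x).left_inv hy
  rw [chartField, mpullbackWithin_apply]
  rw [hl] at h3 ⊢
  obtain ⟨e, he⟩ := h3
  rw [← he] at h2 ⊢
  rw [ContinuousLinearMap.inverse_equiv]
  have h4 := congrArg (fun L : E →L[ℝ] E => L (X y)) h2
  have h5 : e (mfderiv 𝓘(ℝ, E) 𝓘(ℝ, E) (extChartAt 𝓘(ℝ, E) x) y (X y)) = X y := h4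
  exact (e.symm_apply_eq).2 h5.symm

variable [CompleteSpace E]

theorem differentiableAt_chartField {X : Π x : M, TangentSpace 𝓘(ℝ, E) x} {x : M}
    (hX : MDiffAt (T% X) x) : DifferentiableAt ℝ (chartField X x) (extChartAt 𝓘(ℝ, E) x x) := by
  have h := MDifferentiableWithinAt.differentiableWithinAt_mpullbackWithin_vectorField
    (I := 𝓘(ℝ, E)) (s := Set.univ) hX.mdifferentiableWithinAt
  rw [← differentiableWithinAt_univ]
  simpa [chartField] using h

/-- The bracket on a manifold is the bracket of the chart readings, pulled back by the chart;
applying the differential of the chart undoes the pullback. -/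
theorem mfderiv_extChartAt_mlieBracket (X Y : Π x : M, TangentSpace 𝓘(ℝ, E) x) (x : M) :
    mfderiv 𝓘(ℝ, E) 𝓘(ℝ, E) (extChartAt 𝓘(ℝ, E) x) x (mlieBracket 𝓘(ℝ, E) X Y x) =
      lieBracket ℝ (chartField X x) (chartField Y x) (extChartAt 𝓘(ℝ, E) x x) := by
  have h := isInvertible_mfderiv_extChartAt (I := 𝓘(ℝ, E)) (mem_extChartAt_source (I := 𝓘(ℝ, E)) x)
  rw [← mlieBracketWithin_univ, mlieBracketWithin_apply]
  obtain ⟨e, he⟩ := h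
  rw [← he, ContinuousLinearMap.inverse_equiv]
  refine (e.apply_symm_apply _).trans ?_
  change lieBracketWithin ℝ (chartField X x) (chartField Y x) _ _ = _
  rw [← lieBracketWithin_univ]
  simp

/-- The Lie bracket acts on functions as the commutator of the derivations. -/
theorem mvfderiv_mlieBracket {f : M → G} {X Y : Π x : M, TangentSpace 𝓘(ℝ, E) x} {x : M}
    (hf : ContMDiffAt 𝓘(ℝ, E) 𝓘(ℝ, G) ∞ f x) (hX : MDiffAt (T% X) x) (hY : MDiffAt (T% Y) x) :
    mvfderiv 𝓘(ℝ, E) f x (mlieBracket 𝓘(ℝ, E) X Y x) =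
      mvfderiv 𝓘(ℝ, E) (fun y => mvfderiv 𝓘(ℝ, E) f y (Y y)) x (X x) -
        mvfderiv 𝓘(ℝ, E) (fun y => mvfderiv 𝓘(ℝ, E) f y (X y)) x (Y x) := by
  have hx := mem_extChartAt_source (I := 𝓘(ℝ, E)) x
  set h := f ∘ (extChartAt 𝓘(ℝ, E) x).symm with hh
  have hsm : ContDiffAt ℝ ∞ h (extChartAt 𝓘(ℝ, E) x x) := hf.contDiffAt_comp_extChartAt_symm hx
  have hd : DifferentiableAt ℝ (fderiv ℝ h) (extChartAt 𝓘(ℝ, E) x x) :=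
    (hsm.fderiv_right (m := 1) one_add_one_le_infty).differentiableAt one_ne_zero
  have hsymm : IsSymmSndFDerivAt ℝ h (extChartAt 𝓘(ℝ, E) x x) := hsm.isSymmSndFDerivAt (by
    rw [minSmoothness_of_isRCLikeNormedField]; exact two_le_infty)
  have hfd : ∀ᶠ y in 𝓝 x, MDifferentiableAt 𝓘(ℝ, E) 𝓘(ℝ, G) f y := by
    have h2 := contMDiffAt_iff_contMDiffAt_nhds (by simp) |>.1 (hf.of_le one_le_infty)
    filter_upwards [h2] with y hy using hy.mdifferentiableAt one_ne_zero
  -- Product rule in the chart: a Hessian term, and a term in which the field is differentiated. In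
  -- the commutator the Hessian terms cancel by symmetry, and the others form the bracket.
  have key : ∀ Z : Π x : M, TangentSpace 𝓘(ℝ, E) x, ∀ (_ : MDiffAt (T% Z) x)
      (v : TangentSpace 𝓘(ℝ, E) x),
      mvfderiv 𝓘(ℝ, E) (fun y => mvfderiv 𝓘(ℝ, E) f y (Z y)) x v =
        fderiv ℝ (fderiv ℝ h) (extChartAt 𝓘(ℝ, E) x x)
            (mfderiv 𝓘(ℝ, E) 𝓘(ℝ, E) (extChartAt 𝓘(ℝ, E) x) x v)
                (chartField Z x (extChartAt 𝓘(ℝ, E) x x)) +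
          fderiv ℝ h (extChartAt 𝓘(ℝ, E) x x)
              (fderiv ℝ (chartField Z x) (extChartAt 𝓘(ℝ, E) x x)
                  (mfderiv 𝓘(ℝ, E) 𝓘(ℝ, E) (extChartAt 𝓘(ℝ, E) x) x v)) := by
    intro Z hZ v
    have hZd := differentiableAt_chartField hZ
    have heq : (fun y => mvfderiv 𝓘(ℝ, E) f y (Z y)) =ᶠ[𝓝 x]
        (fun z => fderiv ℝ h z (chartField Z x z)) ∘ extChartAt 𝓘(ℝ, E) x := by
      filter_upwards [hfd, extChartAt_source_mem_nhds' hx] with y hy hys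
      rw [mvfderiv_eq_fderiv_extChartAt hys hy, Function.comp_apply,
        chartField_extChartAt Z hys]
    rw [heq.mvfderiv_eq, mvfderiv_comp_extChartAt hx (hd.clm_apply hZd),
      fderiv_clm_apply hd hZd]
    exact add_comm _ _
  rw [key Y hY, key X hX, mvfderiv_eq_fderiv_extChartAt hx hfd.self_of_nhds,
    mfderiv_extChartAt_mlieBracket, ← chartField_extChartAt X hx, ← chartField_extChartAt Y hx,
    lieBracket, map_sub, hsymm.eq]
  abel

end ChartCalculus

/-! ### Exchanging a parameter derivative with a differential -/

section ParameterDerivative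

variable {E : Type*} [NormedAddCommGroup E] [NormedSpace ℝ E]
  {M : Type*} [TopologicalSpace M] [ChartedSpace E M] [IsManifold 𝓘(ℝ, E) ∞ M]

/-- Both iterated derivatives are values of the second differential of `h` at `(t, z)` on the pair
`(1, 0)`, `(0, u)`, taken in opposite orders. -/
theorem hasDerivAt_fderiv_of_contDiffAt {h : ℝ × E → ℝ} {t : ℝ} {z : E}
    (hh : ContDiffAt ℝ ∞ h (t, z)) (u : E) :
    HasDerivAt (fun s => fderiv ℝ (fun z => h (s, z)) z u)
      (fderiv ℝ (fun z => deriv (fun s => h (s, z)) t) z u) t := by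
  have hd : HasFDerivAt (fderiv ℝ h) (fderiv ℝ (fderiv ℝ h) (t, z)) (t, z) :=
    ((hh.fderiv_right (m := 1) one_add_one_le_infty).differentiableAt
      one_ne_zero).hasFDerivAt
  have hsymm : IsSymmSndFDerivAt ℝ h (t, z) := hh.isSymmSndFDerivAt (by
    rw [minSmoothness_of_isRCLikeNormedField]; exact two_le_infty)
  have hev : ∀ᶠ p in 𝓝 (t, z), DifferentiableAt ℝ h p := by
    have h2 := (hh.of_le (m := 1) one_le_infty).eventually (by simp)
    filter_upwards [h2] with y hy using hy.differentiableAt one_ne_zero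
  have hs : ∀ s, HasFDerivAt (fun z => ((s, z) : ℝ × E)) (ContinuousLinearMap.inr ℝ ℝ E) z :=
    fun s => hasFDerivAt_prodMk_right s z
  have ht : HasDerivAt (fun s => ((s, z) : ℝ × E)) ((1 : ℝ), (0 : E)) t :=
    (hasDerivAt_id t).prodMk (hasDerivAt_const t z)
  have hs' : ContinuousAt (fun s => ((s, z) : ℝ × E)) t := by fun_prop
  have hz' : ContinuousAt (fun z => ((t, z) : ℝ × E)) z := by fun_prop
  have e1 : (fun s => fderiv ℝ (fun z => h (s, z)) z u) =ᶠ[𝓝 t]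
      fun s => fderiv ℝ h (s, z) ((0 : ℝ), u) := by
    filter_upwards [hs'.eventually hev] with s hsd
    have := (hsd.hasFDerivAt.comp z (hs s)).fderiv
    change fderiv ℝ (h ∘ fun z => (s, z)) z u = _
    rw [this]
    simp
  have e2 : (fun z => deriv (fun s => h (s, z)) t) =ᶠ[𝓝 z]
      fun z => fderiv ℝ h (t, z) ((1 : ℝ), (0 : E)) := by
    filter_upwards [hz'.eventually hev] with w hw
    exact (hw.hasFDerivAt.comp_hasDerivAt t
      ((hasDerivAt_id t).prodMk (hasDerivAt_const t w))).deriv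
  have d2 : HasFDerivAt (fun z => fderiv ℝ h (t, z) ((1 : ℝ), (0 : E)))
      ((ContinuousLinearMap.apply ℝ ℝ ((1 : ℝ), (0 : E))).comp
        ((fderiv ℝ (fderiv ℝ h) (t, z)).comp (ContinuousLinearMap.inr ℝ ℝ E))) z :=
    (ContinuousLinearMap.apply ℝ ℝ ((1 : ℝ), (0 : E))).hasFDerivAt.comp z (hd.comp z (hs t))
  have d1 : HasDerivAt (fun s => fderiv ℝ h (s, z) ((0 : ℝ), u))
      (fderiv ℝ (fderiv ℝ h) (t, z) ((1 : ℝ), (0 : E)) ((0 : ℝ), u)) t :=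
    (ContinuousLinearMap.apply ℝ ℝ ((0 : ℝ), u)).hasFDerivAt.comp_hasDerivAt t
      (hd.comp_hasDerivAt t ht)
  rw [e2.fderiv_eq, d2.fderiv]
  refine (d1.congr_of_eventuallyEq e1).congr_deriv ?_
  rw [hsymm.eq ((1 : ℝ), (0 : E)) ((0 : ℝ), u)]
  rfl

/-- The derivative in a parameter commutes with the differential. -/
theorem hasDerivAt_mvfderiv {f : ℝ → M → ℝ} {t : ℝ} {x : M}
    (hf : ContMDiffAt (𝓘(ℝ, ℝ).prod 𝓘(ℝ, E)) 𝓘(ℝ, ℝ) ∞ (fun p : ℝ × M => f p.1 p.2) (t, x))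
    (v : TangentSpace 𝓘(ℝ, E) x) :
    HasDerivAt (fun s => mvfderiv 𝓘(ℝ, E) (f s) x v)
      (mvfderiv 𝓘(ℝ, E) (fun y => deriv (fun s => f s y) t) x v) t := by
  have hx := mem_extChartAt_source (I := 𝓘(ℝ, E)) x
  set h : ℝ × E → ℝ := fun p => f p.1 ((extChartAt 𝓘(ℝ, E) x).symm p.2) with hh
  have hsm : ContDiffAt ℝ ∞ h (t, (extChartAt 𝓘(ℝ, E) x x)) := by
    -- The product of the models of `ℝ` and `E` is the model of `ℝ × E`, so smoothness of the family
    -- on the manifold becomes ordinary smoothness of `h`.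
    rw [← contMDiffAt_iff_contDiffAt, modelWithCornersSelf_prod, ← chartedSpaceSelf_prod]
    have h2 : ContMDiffAt (𝓘(ℝ, ℝ).prod 𝓘(ℝ, E)) (𝓘(ℝ, ℝ).prod 𝓘(ℝ, E)) ∞
        (Prod.map id (extChartAt 𝓘(ℝ, E) x).symm) (t, (extChartAt 𝓘(ℝ, E) x x)) :=
      contMDiffAt_id.prodMap (contMDiffAt_extChartAt_symm_of_mem hx)
    exact ContMDiffAt.comp_of_eq (y := (t, x)) hf h2
      (by simp only [Prod.map_apply, id_eq, (extChartAt 𝓘(ℝ, E) x).left_inv hx])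
  have hev : ∀ᶠ p in 𝓝 (t, (extChartAt 𝓘(ℝ, E) x x)), DifferentiableAt ℝ h p := by
    have h2 := (hsm.of_le (m := 1) one_le_infty).eventually (by simp)
    filter_upwards [h2] with y hy using hy.differentiableAt one_ne_zero
  have e : ∀ (q : M → ℝ), q =ᶠ[𝓝 x] (q ∘ (extChartAt 𝓘(ℝ, E) x).symm) ∘ extChartAt 𝓘(ℝ, E) x :=
    fun q => comp_extChartAt_symm_comp_eventuallyEq q hx
  have hs' : ContinuousAt (fun s => ((s, (extChartAt 𝓘(ℝ, E) x x)) : ℝ × E)) t := by fun_prop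
  have main := hasDerivAt_fderiv_of_contDiffAt hsm
      (mfderiv 𝓘(ℝ, E) 𝓘(ℝ, E) (extChartAt 𝓘(ℝ, E) x) x v)
  have hdd : DifferentiableAt ℝ (fun z => deriv (fun s => h (s, z)) t) (extChartAt 𝓘(ℝ, E) x x) :=
      by
    have hz' : ContinuousAt (fun z => ((t, z) : ℝ × E)) (extChartAt 𝓘(ℝ, E) x x) := by fun_prop
    have hd := (hsm.fderiv_right (m := 1) one_add_one_le_infty).differentiableAt one_ne_zero
    have d2 : DifferentiableAt ℝ (fun z => fderiv ℝ h (t, z) ((1 : ℝ), (0 : E)))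
        (extChartAt 𝓘(ℝ, E) x x) :=
      (hd.comp (extChartAt 𝓘(ℝ, E) x x)
          (hasFDerivAt_prodMk_right t (extChartAt 𝓘(ℝ, E) x x)).differentiableAt).clm_apply
        (differentiableAt_const _)
    refine d2.congr_of_eventuallyEq ?_
    filter_upwards [hz'.eventually hev] with w hw
    exact (hw.hasFDerivAt.comp_hasDerivAt t
      ((hasDerivAt_id t).prodMk (hasDerivAt_const t w))).deriv
  have e3 : mvfderiv 𝓘(ℝ, E) (fun y => deriv (fun s => f s y) t) x v =
      fderiv ℝ (fun z => deriv (fun s => h (s, z)) t) (extChartAt 𝓘(ℝ, E) x x)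
        (mfderiv 𝓘(ℝ, E) 𝓘(ℝ, E) (extChartAt 𝓘(ℝ, E) x) x v) := by
    rw [(e fun y => deriv (fun s => f s y) t).mvfderiv_eq]
    exact mvfderiv_comp_extChartAt hx hdd v
  rw [e3]
  refine main.congr_of_eventuallyEq ?_
  filter_upwards [hs'.eventually hev] with s hs
  rw [(e (f s)).mvfderiv_eq]
  exact mvfderiv_comp_extChartAt hx
      (hs.comp (extChartAt 𝓘(ℝ, E) x x)
          (hasFDerivAt_prodMk_right s (extChartAt 𝓘(ℝ, E) x x)).differentiableAt) v

end ParameterDerivative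

/-! ### Smoothness criteria for bilinear forms and vector fields -/

section SmoothSections

variable {E : Type*} [NormedAddCommGroup E] [NormedSpace ℝ E] [FiniteDimensional ℝ E]
  {M : Type*} [TopologicalSpace M] [ChartedSpace E M] [IsManifold 𝓘(ℝ, E) ∞ M]
  {E' : Type*} [NormedAddCommGroup E'] [NormedSpace ℝ E']
  {H' : Type*} [TopologicalSpace H'] {I' : ModelWithCorners ℝ E' H'}
  {P : Type*} [TopologicalSpace P] [ChartedSpace H' P]

/-- The base map `b` covers both uses: `Prod.snd` for families of metrics depending on `t`, and the
submersion for `gN` evaluated along it. -/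
theorem contMDiffAt_bilin_apply {b : P → M}
    {T : Π p : P, TangentSpace 𝓘(ℝ, E) (b p) →L[ℝ] TangentSpace 𝓘(ℝ, E) (b p) →L[ℝ] ℝ}
    {X Y : Π p : P, TangentSpace 𝓘(ℝ, E) (b p)} {p₀ : P} {n : WithTop ℕ∞}
    (hT : ContMDiffAt I' (𝓘(ℝ, E).prod 𝓘(ℝ, E →L[ℝ] E →L[ℝ] ℝ)) n
      (fun p => TotalSpace.mk' (E →L[ℝ] E →L[ℝ] ℝ)
        (E := fun x : M => TangentSpace 𝓘(ℝ, E) x →L[ℝ] TangentSpace 𝓘(ℝ, E) x →L[ℝ] ℝ)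
        (b p) (T p)) p₀)
    (hX : ContMDiffAt I' 𝓘(ℝ, E).tangent n
      (fun p => (⟨b p, X p⟩ : TangentBundle 𝓘(ℝ, E) M)) p₀)
    (hY : ContMDiffAt I' 𝓘(ℝ, E).tangent n
      (fun p => (⟨b p, Y p⟩ : TangentBundle 𝓘(ℝ, E) M)) p₀) :
    ContMDiffAt I' 𝓘(ℝ, ℝ) n (fun p => T p (X p) (Y p)) p₀ := by
  have h : ContMDiffAt I' (𝓘(ℝ, E).prod 𝓘(ℝ, ℝ)) n
      (fun p ↦ TotalSpace.mk' ℝ (E := Bundle.Trivial M ℝ) (b p) (T p (X p) (Y p))) p₀ := by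
    apply ContMDiffAt.clm_bundle_apply₂ (F₁ := E) (F₂ := E)
    · exact hT
    · exact hX
    · exact hY
  simp only [contMDiffAt_totalSpace] at h
  exact h.2

/-- In finite dimension a linear map is a fixed linear expression in its values on a basis. -/
theorem contMDiffAt_clm_of_apply {V G : Type*} [NormedAddCommGroup V] [NormedSpace ℝ V]
    [FiniteDimensional ℝ V] [NormedAddCommGroup G] [NormedSpace ℝ G] {n : WithTop ℕ∞}
    {f : P → V →L[ℝ] G} {p₀ : P} (h : ∀ v, ContMDiffAt I' 𝓘(ℝ, G) n (fun p => f p v) p₀) :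
    ContMDiffAt I' 𝓘(ℝ, V →L[ℝ] G) n f p₀ := by
  let b := Module.finBasis ℝ V
  have hf : f = fun p => ∑ i, ContinuousLinearMap.smulRightL ℝ V G
      (LinearMap.toContinuousLinearMap (b.coord i)) (f p (b i)) := by
    funext p
    ext v
    conv_lhs => rw [← b.sum_repr v]
    simp only [map_sum, map_smul]
    simp
  rw [hf]
  refine ContMDiffAt.sum fun i _ => ?_
  exact (ContinuousLinearMap.contMDiff _).contMDiffAt.comp p₀ (h (b i))

/-- Bilinear forms are sections of a nested hom bundle, so the coordinate change is unfolded twice;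
the innermost target is a trivial bundle and contributes nothing. -/
theorem inCoordinates_bilin_apply {x y : M}
    (T : TangentSpace 𝓘(ℝ, E) y →L[ℝ] TangentSpace 𝓘(ℝ, E) y →L[ℝ] ℝ)
    (hy : y ∈ (trivializationAt E (TangentSpace 𝓘(ℝ, E) : M → Type _) x).baseSet) (u v : E) :
    ContinuousLinearMap.inCoordinates E (TangentSpace 𝓘(ℝ, E) : M → Type _) (E →L[ℝ] ℝ)
      (fun x : M => TangentSpace 𝓘(ℝ, E) x →L[ℝ] ℝ) x y x y T u v =
    T ((trivializationAt E (TangentSpace 𝓘(ℝ, E) : M → Type _) x).symm y u)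
      ((trivializationAt E (TangentSpace 𝓘(ℝ, E) : M → Type _) x).symm y v) := by
  have hy' : y ∈ (trivializationAt (E →L[ℝ] ℝ)
      (fun x : M => TangentSpace 𝓘(ℝ, E) x →L[ℝ] ℝ) x).baseSet := by
    rw [hom_trivializationAt_baseSet]
    exact ⟨hy, by simp⟩
  rw [ContinuousLinearMap.inCoordinates, ContinuousLinearMap.comp_apply,
    ContinuousLinearMap.comp_apply, Trivialization.continuousLinearMapAt_apply,
    Trivialization.coe_linearMapAt_of_mem _ hy', Trivialization.symmL_apply _ hy]
  change ContinuousLinearMap.inCoordinates E (TangentSpace 𝓘(ℝ, E) : M → Type _) ℝ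
    (Bundle.Trivial M ℝ) x y x y _ v = _
  rw [ContinuousLinearMap.inCoordinates, ContinuousLinearMap.comp_apply,
    ContinuousLinearMap.comp_apply, Trivialization.symmL_apply _ hy]
  simp

/-- A family of bilinear forms on the tangent spaces is smooth if its values on local extensions
of tangent vectors are. -/
theorem contMDiffAt_bilin_of_apply_extend {b : P → M}
    {T : Π p : P, TangentSpace 𝓘(ℝ, E) (b p) →L[ℝ] TangentSpace 𝓘(ℝ, E) (b p) →L[ℝ] ℝ}
    {p₀ : P} {n : WithTop ℕ∞} (hb : ContMDiffAt I' 𝓘(ℝ, E) n b p₀)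
    (hT : ∀ u v : TangentSpace 𝓘(ℝ, E) (b p₀), ContMDiffAt I' 𝓘(ℝ, ℝ) n (fun p =>
      T p (FiberBundle.extend E (E := (TangentSpace 𝓘(ℝ, E) : M → Type _)) u (b p))
        (FiberBundle.extend E (E := (TangentSpace 𝓘(ℝ, E) : M → Type _)) v (b p))) p₀) :
    ContMDiffAt I' (𝓘(ℝ, E).prod 𝓘(ℝ, E →L[ℝ] E →L[ℝ] ℝ)) n
      (fun p => TotalSpace.mk' (E →L[ℝ] E →L[ℝ] ℝ)
        (E := fun x : M => TangentSpace 𝓘(ℝ, E) x →L[ℝ] TangentSpace 𝓘(ℝ, E) x →L[ℝ] ℝ)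
        (b p) (T p)) p₀ := by
  rw [contMDiffAt_hom_bundle]
  refine ⟨hb, contMDiffAt_clm_of_apply fun u => contMDiffAt_clm_of_apply fun v => ?_⟩
  set e := trivializationAt E (TangentSpace 𝓘(ℝ, E) : M → Type _) (b p₀) with he
  have hmem : b p₀ ∈ e.baseSet := FiberBundle.mem_baseSet_trivializationAt' (b p₀)
  -- The extension of `e.symm (b p₀) u` has constant coordinates `u` in `e`, so near `p₀` the matrix
  -- entries of `T` are exactly the functions assumed smooth.
  refine (hT (e.symm (b p₀) u) (e.symm (b p₀) v)).congr_of_eventuallyEq ?_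
  filter_upwards [hb.continuousAt.preimage_mem_nhds (e.open_baseSet.mem_nhds hmem)] with p hp
  have hp' : b p ∈ e.baseSet := hp
  change ContinuousLinearMap.inCoordinates E (TangentSpace 𝓘(ℝ, E) : M → Type _) (E →L[ℝ] ℝ)
      (fun x : M => TangentSpace 𝓘(ℝ, E) x →L[ℝ] ℝ) (b p₀) (b p) (b p₀) (b p) (T p) u v = _
  rw [inCoordinates_bilin_apply _ hp']
  simp [FiberBundle.extend, ← he, hmem]

/-- A vector field is smooth if its scalar products with local extensions of tangent vectors are. -/
theorem contMDiffAt_of_inner_extend (g : SmoothMetric E M) {X : Π x : M, TangentSpace 𝓘(ℝ, E) x}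
    {x : M}
    (hX : ∀ v : TangentSpace 𝓘(ℝ, E) x, ContMDiffAt 𝓘(ℝ, E) 𝓘(ℝ, ℝ) ∞ (fun y => g.inner y (X y)
        (FiberBundle.extend E (E := (TangentSpace 𝓘(ℝ, E) : M → Type _)) v y)) x) :
    CMDiffAt ∞ (T% X) x := by
  have hg := g.contMDiff x
  rw [contMDiffAt_hom_bundle] at hg
  set e := trivializationAt E (TangentSpace 𝓘(ℝ, E) : M → Type _) x with he
  have hmem : x ∈ e.baseSet := FiberBundle.mem_baseSet_trivializationAt' x
  set A : M → E →L[ℝ] E →L[ℝ] ℝ := fun y =>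
    ContinuousLinearMap.inCoordinates E (TangentSpace 𝓘(ℝ, E) : M → Type _) (E →L[ℝ] ℝ)
      (fun x : M => TangentSpace 𝓘(ℝ, E) x →L[ℝ] ℝ) x y x y (g.inner y) with hA
  have hA_smooth : ContMDiffAt 𝓘(ℝ, E) 𝓘(ℝ, E →L[ℝ] E →L[ℝ] ℝ) ∞ A x := hg.2
  have hA_apply : ∀ y ∈ e.baseSet, ∀ u v, A y u v = g.inner y (e.symm y u) (e.symm y v) :=
    fun y hy u v => inCoordinates_bilin_apply _ hy u v
  -- Positive definiteness gives injectivity, and a space has the same dimension as its dual.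
  have hA_inv : ∀ y ∈ e.baseSet, (A y).IsInvertible := by
    intro y hy
    have hinj : Function.Injective (A y) := by
      rw [injective_iff_map_eq_zero]
      intro u hu
      by_contra hne
      have h0 : e.symm y u ≠ 0 := by
        intro h0
        apply hne
        have := (e.continuousLinearEquivAt ℝ y hy).symm.map_eq_zero_iff (x := u)
        exact this.1 h0
      have := g.pos y _ h0
      rw [← hA_apply y hy, hu] at this
      simp at this
    have hbij : Function.Bijective (A y) := by
      refine ⟨hinj, ?_⟩
      refine (LinearMap.injective_iff_surjective_of_finrank_eq_finrank
        (f := (A y).toLinearMap) ?_).1 hinj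
      rw [LinearEquiv.finrank_eq (LinearMap.toContinuousLinearMap (𝕜 := ℝ) (E := E) (F' := ℝ)).symm]
      exact Subspace.dual_finrank_eq.symm
    exact ⟨(LinearEquiv.ofBijective (A y).toLinearMap hbij).toContinuousLinearEquiv, rfl⟩
  rw [contMDiffAt_section]
  -- In coordinates, `X` is the inverse of the metric applied to the covector `g(X, ·)`. That
  -- covector is smooth by hypothesis, and inversion is smooth at an invertible map.
  have hθ : ContMDiffAt 𝓘(ℝ, E) 𝓘(ℝ, E →L[ℝ] ℝ) ∞ (fun y => A y (e ⟨y, X y⟩).2) x := by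
    refine contMDiffAt_clm_of_apply fun v => ?_
    refine (hX (e.symm x v)).congr_of_eventuallyEq ?_
    filter_upwards [e.open_baseSet.mem_nhds hmem] with y hy
    rw [hA_apply y hy, e.symm_apply_apply_mk hy]
    simp [FiberBundle.extend, ← he, hmem]
  have hinv : ContMDiffAt 𝓘(ℝ, E) 𝓘(ℝ, (E →L[ℝ] ℝ) →L[ℝ] E) ∞ (fun y => (A y).inverse) x :=
    ((hA_inv x hmem).contDiffAt_map_inverse).contMDiffAt.comp x hA_smooth
  refine (hinv.clm_apply hθ).congr_of_eventuallyEq ?_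
  filter_upwards [e.open_baseSet.mem_nhds hmem] with y hy
  obtain ⟨L, hL⟩ := hA_inv y hy
  rw [← hL, ContinuousLinearMap.inverse_equiv]
  exact (L.symm_apply_apply _).symm

/-- Every tangent vector extends to a smooth vector field. -/
theorem exists_contMDiff_vectorField [T2Space M] {x : M} (v : TangentSpace 𝓘(ℝ, E) x) :
    ∃ X : Π x : M, TangentSpace 𝓘(ℝ, E) x, CMDiff ∞ (T% X) ∧ X x = v := by
  obtain ⟨s, hs, hsX⟩ := FiberBundle.exists_contMDiffOn_extend (k := ∞) 𝓘(ℝ, E) E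
    (V := (TangentSpace 𝓘(ℝ, E) : M → Type _)) v
  -- A bump function equal to `1` at `x` and supported where the local extension is smooth makes it
  -- global.
  obtain ⟨ψ, -, hψ⟩ := (SmoothBumpFunction.nhds_basis_tsupport (I := 𝓘(ℝ, E)) x).mem_iff.1
    (interior_mem_nhds.2 hs)
  refine ⟨fun y => ψ y • FiberBundle.extend E
    (E := (TangentSpace 𝓘(ℝ, E) : M → Type _)) v y, ?_, by simp⟩
  exact ContMDiffOn.smul_section_of_tsupport ψ.contMDiff.contMDiffOn isOpen_interior hψ
    (hsX.mono interior_subset)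

end SmoothSections

/-! ### Vertical and horizontal spaces -/

section FiberwiseAlgebra

variable {E : Type*} [NormedAddCommGroup E] [NormedSpace ℝ E] [FiniteDimensional ℝ E]
  {M : Type*} [TopologicalSpace M] [ChartedSpace E M] [IsManifold 𝓘(ℝ, E) ∞ M]
  {F : Type*} [NormedAddCommGroup F] [NormedSpace ℝ F] [FiniteDimensional ℝ F]
  {N : Type*} [TopologicalSpace N] [ChartedSpace F N] [IsManifold 𝓘(ℝ, F) ∞ N]

section Projections

variable (g : SmoothMetric E M) (pr : M → N) (x : M)

theorem mem_verticalSpace {pr : M → N} {x : M} {u : TangentSpace 𝓘(ℝ, E) x} :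
    u ∈ verticalSpace (F := F) pr x ↔ mfderiv 𝓘(ℝ, E) 𝓘(ℝ, F) pr x u = 0 :=
  LinearMap.mem_ker

theorem verticalProj_mem (u : TangentSpace 𝓘(ℝ, E) x) :
    verticalProj (F := F) g pr x u ∈ verticalSpace (F := F) pr x :=
  Submodule.projection_apply_mem _ u

theorem horizontalProj_mem (u : TangentSpace 𝓘(ℝ, E) x) :
    horizontalProj (F := F) g pr x u ∈ horizontalSpace (F := F) g pr x :=
  Submodule.projection_apply_mem _ u

theorem verticalProj_add_horizontalProj (u : TangentSpace 𝓘(ℝ, E) x) :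
    verticalProj (F := F) g pr x u + horizontalProj (F := F) g pr x u = u :=
  Submodule.projection_add_projection_eq_self (isCompl_vertical_horizontal (F := F) g pr x) u

variable {g pr x}

theorem verticalProj_of_mem {u : TangentSpace 𝓘(ℝ, E) x} (hu : u ∈ verticalSpace (F := F) pr x) :
    verticalProj (F := F) g pr x u = u :=
  Submodule.projection_apply_of_mem_left (isCompl_vertical_horizontal (F := F) g pr x) hu

theorem horizontalProj_of_mem_vertical {u : TangentSpace 𝓘(ℝ, E) x}
    (hu : u ∈ verticalSpace (F := F) pr x) : horizontalProj (F := F) g pr x u = 0 := by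
  have h := verticalProj_add_horizontalProj (F := F) g pr x u
  rwa [verticalProj_of_mem hu, add_eq_left] at h

theorem horizontalProj_of_mem {u : TangentSpace 𝓘(ℝ, E) x}
    (hu : u ∈ horizontalSpace (F := F) g pr x) : horizontalProj (F := F) g pr x u = u :=
  Submodule.projection_apply_of_mem_left (isCompl_vertical_horizontal (F := F) g pr x).symm hu

theorem mem_horizontalSpace {u : TangentSpace 𝓘(ℝ, E) x} :
    u ∈ horizontalSpace (F := F) g pr x ↔
      ∀ v ∈ verticalSpace (F := F) pr x, g.inner x v u = 0 :=
  Iff.rfl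

theorem inner_vertical_horizontal {u v : TangentSpace 𝓘(ℝ, E) x}
    (hu : u ∈ verticalSpace (F := F) pr x) (hv : v ∈ horizontalSpace (F := F) g pr x) :
    g.inner x u v = 0 :=
  hv u hu

theorem inner_horizontal_vertical {u v : TangentSpace 𝓘(ℝ, E) x}
    (hu : u ∈ horizontalSpace (F := F) g pr x) (hv : v ∈ verticalSpace (F := F) pr x) :
    g.inner x u v = 0 := by
  rw [g.symm, inner_vertical_horizontal hv hu]

theorem mfderiv_horizontalProj (u : TangentSpace 𝓘(ℝ, E) x) :
    mfderiv 𝓘(ℝ, E) 𝓘(ℝ, F) pr x (horizontalProj (F := F) g pr x u) =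
      mfderiv 𝓘(ℝ, E) 𝓘(ℝ, F) pr x u := by
  have h := congrArg (mfderiv 𝓘(ℝ, E) 𝓘(ℝ, F) pr x)
      (verticalProj_add_horizontalProj (F := F) g pr x u)
  rwa [map_add, mem_verticalSpace.1 (verticalProj_mem (F := F) g pr x u), zero_add] at h

/-- The difference is both vertical and horizontal. This uniqueness is what identifies horizontal
lifts. -/
theorem eq_of_mem_horizontalSpace {u v : TangentSpace 𝓘(ℝ, E) x}
    (hu : u ∈ horizontalSpace (F := F) g pr x) (hv : v ∈ horizontalSpace (F := F) g pr x)
    (h : mfderiv 𝓘(ℝ, E) 𝓘(ℝ, F) pr x u = mfderiv 𝓘(ℝ, E) 𝓘(ℝ, F) pr x v) : u = v := by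
  have h1 : u - v ∈ verticalSpace (F := F) pr x := by
    rw [mem_verticalSpace, map_sub, h, sub_self]
  exact sub_eq_zero.1 (Submodule.disjoint_def.1
      (isCompl_vertical_horizontal (F := F) g pr x).disjoint _ h1
    (sub_mem hu hv))

theorem inner_horizontalProj_left {u v : TangentSpace 𝓘(ℝ, E) x}
    (hv : v ∈ horizontalSpace (F := F) g pr x) :
    g.inner x (horizontalProj (F := F) g pr x u) v = g.inner x u v := by
  conv_rhs => rw [← verticalProj_add_horizontalProj (F := F) g pr x u]
  rw [map_add, add_apply, inner_vertical_horizontal (verticalProj_mem (F := F) g pr x u) hv,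
    zero_add]

theorem horizontalLift_mem (w : TangentSpace 𝓘(ℝ, F) (pr x)) :
    horizontalLift g pr x w ∈ horizontalSpace (F := F) g pr x :=
  horizontalProj_mem (F := F) g pr x _

/-- Vertical spaces carry the same orthonormal basis for metrics that agree on them. -/
theorem verticalBasis_congr {g g' : SmoothMetric E M}
    (h : ∀ u ∈ verticalSpace (F := F) pr x, ∀ v ∈ verticalSpace (F := F) pr x,
      g.inner x u v = g'.inner x u v) :
    verticalBasis (F := F) g pr x = verticalBasis (F := F) g' pr x := by
  have h1 : verticalForm (F := F) g pr x = verticalForm (F := F) g' pr x := by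
    ext u v
    exact h u u.2 v v.2
  unfold verticalBasis
  congr 1

variable (g pr x) in
theorem verticalBasis_mem (a) :
    (verticalBasis (F := F) g pr x a : TangentSpace 𝓘(ℝ, E) x) ∈ verticalSpace (F := F) pr x :=
  (verticalBasis (F := F) g pr x a).2

theorem inner_verticalBasis (a b) :
    g.inner x (verticalBasis (F := F) g pr x a) (verticalBasis (F := F) g pr x b) =
      if a = b then 1 else 0 :=
  formOrthonormalBasis_orthonormal (verticalForm (F := F) g pr x)
    (verticalForm_isScalarProduct g pr x) a b

theorem sum_inner_verticalBasis {u : TangentSpace 𝓘(ℝ, E) x}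
    (hu : u ∈ verticalSpace (F := F) pr x) :
    ∑ a, g.inner x u (verticalBasis (F := F) g pr x a) •
      (verticalBasis (F := F) g pr x a : TangentSpace 𝓘(ℝ, E) x) = u := by
  have hcoe : ∀ c : verticalSpace (E := E) (F := F) pr x, (c : TangentSpace 𝓘(ℝ, E) x) =
      ∑ a, (verticalBasis (F := F) g pr x).repr c a •
        (verticalBasis (F := F) g pr x a : TangentSpace 𝓘(ℝ, E) x) := by
    intro c
    refine (congrArg (Submodule.subtype _)
      ((verticalBasis (F := F) g pr x).sum_repr c)).symm.trans ?_
    rw [map_sum]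
    rfl
  have key : ∀ a, g.inner x u (verticalBasis (F := F) g pr x a) =
      (verticalBasis (F := F) g pr x).repr ⟨u, hu⟩ a := by
    intro a
    have := hcoe ⟨u, hu⟩
    simp only at this
    conv_lhs => rw [this]
    simp [inner_verticalBasis]
  simp only [key]
  exact (hcoe ⟨u, hu⟩).symm

/-- The vertical projection in an orthonormal basis. -/
theorem verticalProj_eq_sum (u : TangentSpace 𝓘(ℝ, E) x) :
    verticalProj (F := F) g pr x u = ∑ a, g.inner x u (verticalBasis (F := F) g pr x a) •
      (verticalBasis (F := F) g pr x a : TangentSpace 𝓘(ℝ, E) x) := by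
  rw [← sum_inner_verticalBasis (g := g) (verticalProj_mem (F := F) g pr x u)]
  refine Finset.sum_congr rfl fun a _ => ?_
  congr 1
  conv_rhs => rw [← verticalProj_add_horizontalProj (F := F) g pr x u]
  rw [map_add, add_apply, inner_horizontal_vertical (horizontalProj_mem (F := F) g pr x u)
    (verticalBasis_mem (F := F) g pr x a), add_zero]

end Projections

/-! ### Horizontal lifts -/

namespace IsRiemannianSubmersion

variable {pr : M → N} {g g' : SmoothMetric E M} {gN : SmoothMetric F N}

theorem mfderiv_horizontalLift (hs : IsRiemannianSubmersion pr g gN) (g' : SmoothMetric E M) {x : M}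
    (w : TangentSpace 𝓘(ℝ, F) (pr x)) :
    mfderiv 𝓘(ℝ, E) 𝓘(ℝ, F) pr x (horizontalLift g' pr x w) = w := by
  rw [horizontalLift, mfderiv_horizontalProj]
  exact Function.invFun_eq (hs.surjective x w)

theorem eq_horizontalLift (hs : IsRiemannianSubmersion pr g gN) {x : M}
    {u : TangentSpace 𝓘(ℝ, E) x} (hu : u ∈ horizontalSpace (F := F) g pr x)
    {w : TangentSpace 𝓘(ℝ, F) (pr x)} (h : mfderiv 𝓘(ℝ, E) 𝓘(ℝ, F) pr x u = w) :
    horizontalLift g pr x w = u :=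
  eq_of_mem_horizontalSpace (horizontalLift_mem w) hu (by rw [hs.mfderiv_horizontalLift, h])

theorem horizontalLift_mfderiv (hs : IsRiemannianSubmersion pr g gN) {x : M}
    (u : TangentSpace 𝓘(ℝ, E) x) :
    horizontalLift g pr x (mfderiv 𝓘(ℝ, E) 𝓘(ℝ, F) pr x u) = horizontalProj (F := F) g pr x u :=
  hs.eq_horizontalLift (horizontalProj_mem (F := F) g pr x u) (mfderiv_horizontalProj u)

theorem horizontalLift_eq (hs : IsRiemannianSubmersion pr g gN) (g' : SmoothMetric E M) {x : M}
    (w : TangentSpace 𝓘(ℝ, F) (pr x)) :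
    horizontalLift g pr x w = horizontalProj (F := F) g pr x (horizontalLift g' pr x w) := by
  rw [← hs.horizontalLift_mfderiv, hs.mfderiv_horizontalLift]

/-- Only the horizontal part of `u` pairs with the lift, and there the submersion is isometric. So
the lift is the metric dual of a covector built from `gN` and the differential of `pr`. -/
theorem inner_horizontalLift (hs : IsRiemannianSubmersion pr g gN) {x : M}
    (w : TangentSpace 𝓘(ℝ, F) (pr x)) (u : TangentSpace 𝓘(ℝ, E) x) :
    g.inner x (horizontalLift g pr x w) u =
      gN.inner (pr x) w (mfderiv 𝓘(ℝ, E) 𝓘(ℝ, F) pr x u) := by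
  rw [g.symm, ← inner_horizontalProj_left (F := F) (horizontalLift_mem w),
    hs.isometry x _ (horizontalProj_mem (F := F) g pr x u) _ (horizontalLift_mem w),
    mfderiv_horizontalProj, hs.mfderiv_horizontalLift, gN.symm]

theorem mdifferentiableAt (hs : IsRiemannianSubmersion pr g gN) (x : M) :
    MDifferentiableAt 𝓘(ℝ, E) 𝓘(ℝ, F) pr x :=
  (hs.contMDiff x).mdifferentiableAt (by simp)

/-- The horizontal lift of a smooth vector field along the submersion is smooth. -/
theorem contMDiffAt_horizontalLift (hs : IsRiemannianSubmersion pr g gN) {x : M}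
    {s : Π y : M, TangentSpace 𝓘(ℝ, F) (pr y)}
    (h : ContMDiffAt 𝓘(ℝ, E) 𝓘(ℝ, F).tangent ∞
      (fun y => (⟨pr y, s y⟩ : TangentBundle 𝓘(ℝ, F) N)) x) :
    CMDiffAt ∞ (T% (fun y => horizontalLift g pr y (s y))) x := by
  -- The lift is defined through a choice of preimages; its scalar products with local fields do not
  -- involve that choice and are visibly smooth.
  refine contMDiffAt_of_inner_extend g fun v => ?_
  simp only [hs.inner_horizontalLift]
  refine contMDiffAt_bilin_apply (b := pr) ((gN.contMDiff (pr x)).comp x (hs.contMDiff x)) h ?_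
  have h1 : ContMDiffAt 𝓘(ℝ, E) 𝓘(ℝ, F).tangent ∞ ((tangentMap 𝓘(ℝ, E) 𝓘(ℝ, F) pr) ∘
      (T% (FiberBundle.extend E (E := (TangentSpace 𝓘(ℝ, E) : M → Type _)) v))) x :=
    ((hs.contMDiff.contMDiff_tangentMap (m := ∞) (by simp)).contMDiffAt).comp x
      (FiberBundle.contMDiffAt_extend 𝓘(ℝ, E) E v)
  exact h1

theorem contMDiffAt_horizontalLift_field (hs : IsRiemannianSubmersion pr g gN) {x : M}
    {W : Π y : N, TangentSpace 𝓘(ℝ, F) y} (hW : CMDiffAt ∞ (T% W) (pr x)) :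
    CMDiffAt ∞ (T% (fun y => horizontalLift g pr y (W (pr y)))) x :=
  hs.contMDiffAt_horizontalLift (ContMDiffAt.comp x hW (hs.contMDiff x))

/-- The vertical projection is the identity minus the lift of the differential of `pr`, so
smoothness of lifts suffices. -/
theorem contMDiffAt_verticalExtend (hs : IsRiemannianSubmersion pr g gN) {x : M}
    (v : TangentSpace 𝓘(ℝ, E) x) : CMDiffAt ∞ (T% (verticalExtend (F := F) g pr v)) x := by
  have hv : CMDiffAt ∞ (T% (FiberBundle.extend E (E := (TangentSpace 𝓘(ℝ, E) : M → Type _)) v)) x :=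
    FiberBundle.contMDiffAt_extend 𝓘(ℝ, E) E v
  have h1 : ContMDiffAt 𝓘(ℝ, E) 𝓘(ℝ, F).tangent ∞ ((tangentMap 𝓘(ℝ, E) 𝓘(ℝ, F) pr) ∘
      (T% (FiberBundle.extend E (E := (TangentSpace 𝓘(ℝ, E) : M → Type _)) v))) x :=
    ((hs.contMDiff.contMDiff_tangentMap (m := ∞) (by simp)).contMDiffAt).comp x hv
  have h2 := hv.sub_section (hs.contMDiffAt_horizontalLift h1)
  refine h2.congr_of_eventuallyEq (Filter.Eventually.of_forall fun y => ?_)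
  have h3 : verticalExtend (F := F) g pr v y =
      FiberBundle.extend E (E := (TangentSpace 𝓘(ℝ, E) : M → Type _)) v y -
        horizontalLift g pr y (mfderiv 𝓘(ℝ, E) 𝓘(ℝ, F) pr y
          (FiberBundle.extend E (E := (TangentSpace 𝓘(ℝ, E) : M → Type _)) v y)) := by
    rw [hs.horizontalLift_mfderiv, verticalExtend, eq_sub_iff_add_eq,
      verticalProj_add_horizontalProj]
  simp only [h3]
  rfl

end IsRiemannianSubmersion

theorem verticalExtend_mem (g : SmoothMetric E M) (pr : M → N) {x : M}
    (v : TangentSpace 𝓘(ℝ, E) x) (y : M) :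
    verticalExtend (F := F) g pr v y ∈ verticalSpace (F := F) pr y :=
  verticalProj_mem (F := F) g pr y _

theorem verticalExtend_self {g : SmoothMetric E M} {pr : M → N} {x : M}
    {v : TangentSpace 𝓘(ℝ, E) x} (hv : v ∈ verticalSpace (F := F) pr x) :
    verticalExtend (F := F) g pr v x = v := by
  rw [verticalExtend, FiberBundle.extend_apply_self, verticalProj_of_mem hv]

/-- The bracket of a vertical field with a projectable field is vertical. -/
theorem mlieBracket_mem_verticalSpace {pr : M → N} {x : M}
    (hpr : ContMDiffAt 𝓘(ℝ, E) 𝓘(ℝ, F) ∞ pr x)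
    {Y X : Π x : M, TangentSpace 𝓘(ℝ, E) x} {W : Π y : N, TangentSpace 𝓘(ℝ, F) y}
    (hY : MDiffAt (T% Y) x) (hX : MDiffAt (T% X) x) (hW : MDiffAt (T% W) (pr x))
    (hYV : ∀ᶠ y in 𝓝 x, Y y ∈ verticalSpace (F := F) pr y)
    (hXW : ∀ᶠ y in 𝓝 x, mfderiv 𝓘(ℝ, E) 𝓘(ℝ, F) pr y (X y) = W (pr y)) :
    mlieBracket 𝓘(ℝ, E) Y X x ∈ verticalSpace (F := F) pr x := by
  have hsrc := mem_extChartAt_source (I := 𝓘(ℝ, F)) (pr x)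
  -- Read in a chart of `N`, the submersion becomes a map into `F`, on which the bracket acts as a
  -- commutator of derivations.
  set f : M → F := extChartAt 𝓘(ℝ, F) (pr x) ∘ pr with hf
  have hφ : ∀ z ∈ (extChartAt 𝓘(ℝ, F) (pr x)).source,
      MDifferentiableAt 𝓘(ℝ, F) 𝓘(ℝ, F) (extChartAt 𝓘(ℝ, F) (pr x)) z := fun z hz =>
    mdifferentiableAt_extChartAt (by simpa using hz)
  have hfs : ContMDiffAt 𝓘(ℝ, E) 𝓘(ℝ, F) ∞ f x := (contMDiffAt_extChartAt).comp x hpr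
  have hprd : ∀ᶠ y in 𝓝 x, MDifferentiableAt 𝓘(ℝ, E) 𝓘(ℝ, F) pr y := by
    filter_upwards [contMDiffAt_iff_contMDiffAt_nhds (by simp) |>.1 (hpr.of_le one_le_infty)]
      with y hy using hy.mdifferentiableAt one_ne_zero
  have hsrcE : ∀ᶠ y in 𝓝 x, pr y ∈ (extChartAt 𝓘(ℝ, F) (pr x)).source :=
    hpr.continuousAt.preimage_mem_nhds (extChartAt_source_mem_nhds (I := 𝓘(ℝ, F)) (pr x))
  have hdf : ∀ᶠ y in 𝓝 x, ∀ v : TangentSpace 𝓘(ℝ, E) y, mvfderiv 𝓘(ℝ, E) f y v =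
      mfderiv 𝓘(ℝ, F) 𝓘(ℝ, F) (extChartAt 𝓘(ℝ, F) (pr x)) (pr y)
        (mfderiv 𝓘(ℝ, E) 𝓘(ℝ, F) pr y v) := by
    filter_upwards [hprd, hsrcE] with y hy hys v
    have := mfderiv_comp (I := 𝓘(ℝ, E)) (I' := 𝓘(ℝ, F)) (I'' := 𝓘(ℝ, F)) y (hφ _ hys) hy
    exact congrArg (fun L : E →L[ℝ] F => L v) this
  have h1 := mvfderiv_mlieBracket hfs hY hX
  -- Both terms of the commutator vanish: `Y f = 0` near `x`, and `X f` is the pullback of a map on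
  -- the base, which the vertical field `Y` kills.
  have hYf : (fun y => mvfderiv 𝓘(ℝ, E) f y (Y y)) =ᶠ[𝓝 x] fun _ => 0 := by
    filter_upwards [hdf, hYV] with y hy hyV
    rw [hy, mem_verticalSpace.1 hyV, map_zero]
    rfl
  have hXf : (fun y => mvfderiv 𝓘(ℝ, E) f y (X y)) =ᶠ[𝓝 x]
      (chartField W (pr x) ∘ extChartAt 𝓘(ℝ, F) (pr x)) ∘ pr := by
    filter_upwards [hdf, hXW, hsrcE] with y hy hyW hys
    rw [hy, hyW, Function.comp_apply, Function.comp_apply, chartField_extChartAt W hys]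
  have hd2 : MDifferentiableAt 𝓘(ℝ, F) 𝓘(ℝ, F)
      (chartField W (pr x) ∘ extChartAt 𝓘(ℝ, F) (pr x)) (pr x) :=
    (differentiableAt_chartField hW).mdifferentiableAt.comp (pr x) (hφ _ hsrc)
  have h2 : mvfderiv 𝓘(ℝ, E) ((chartField W (pr x) ∘ extChartAt 𝓘(ℝ, F) (pr x)) ∘ pr) x (Y x) = 0
      := by
    have h3 := mfderiv_comp (I := 𝓘(ℝ, E)) (I' := 𝓘(ℝ, F)) (I'' := 𝓘(ℝ, F)) x hd2 hprd.self_of_nhds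
    refine (congrArg (fun L : E →L[ℝ] F => L (Y x)) h3).trans ?_
    have h4 := mem_verticalSpace.1 hYV.self_of_nhds
    refine (congrArg _ h4).trans ?_
    exact (mfderiv 𝓘(ℝ, F) 𝓘(ℝ, F) (chartField W (pr x) ∘ extChartAt 𝓘(ℝ, F) (pr x))
      (pr x)).map_zero
  rw [hYf.mvfderiv_eq, hXf.mvfderiv_eq, h2, mvfderiv_const, hdf.self_of_nhds] at h1
  rw [mem_verticalSpace]
  obtain ⟨L, hL⟩ := isInvertible_mfderiv_extChartAt (I := 𝓘(ℝ, F)) hsrc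
  rw [← hL] at h1
  refine (L.map_eq_zero_iff).1 (h1.trans ?_)
  exact sub_self (0 : F)

end FiberwiseAlgebra

/-! ### Mean curvature and vertical divergence -/

section MeanCurvature

variable {E : Type*} [NormedAddCommGroup E] [NormedSpace ℝ E] [FiniteDimensional ℝ E]
  {M : Type*} [TopologicalSpace M] [ChartedSpace E M] [IsManifold 𝓘(ℝ, E) ∞ M]
  {F : Type*} [NormedAddCommGroup F] [NormedSpace ℝ F] [FiniteDimensional ℝ F]
  {N : Type*} [TopologicalSpace N] [ChartedSpace F N] [IsManifold 𝓘(ℝ, F) ∞ N]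
  {pr : M → N} {g g' : SmoothMetric E M} {gN : SmoothMetric F N} {x : M}

theorem meanCurvature_mem (g : SmoothMetric E M) (pr : M → N) (x : M) :
    meanCurvature (F := F) g pr x ∈ horizontalSpace (F := F) g pr x :=
  Submodule.sum_mem _ fun _ _ => horizontalProj_mem (F := F) g pr x _

theorem mdifferentiableAt_extend_tangent (u : TangentSpace 𝓘(ℝ, E) x) :
    MDiffAt (T% (FiberBundle.extend E (E := (TangentSpace 𝓘(ℝ, E) : M → Type _)) u)) x :=
  FiberBundle.mdifferentiableAt_extend 𝓘(ℝ, E) E u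

theorem leviCivita_metric_apply (g : SmoothMetric E M) {Y Z : Π x : M, TangentSpace 𝓘(ℝ, E) x}
    (hY : MDiffAt (T% Y) x) (hZ : MDiffAt (T% Z) x) (u : TangentSpace 𝓘(ℝ, E) x) :
    mvfderiv 𝓘(ℝ, E) (fun y => g.inner y (Y y) (Z y)) x u
      = g.inner x (leviCivita g Y x u) (Z x) + g.inner x (Y x) (leviCivita g Z x u) := by
  have h := leviCivita_metric g (mdifferentiableAt_extend_tangent u) hY hZ
  simpa only [FiberBundle.extend_apply_self] using h

theorem IsRiemannianSubmersion.mdifferentiableAt_verticalExtend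
    (hs : IsRiemannianSubmersion pr g gN) (v : TangentSpace 𝓘(ℝ, E) x) :
    MDiffAt (T% (verticalExtend (F := F) g pr v)) x :=
  (hs.contMDiffAt_verticalExtend v).mdifferentiableAt (by simp)

/-- Differentiate the identity $g(Y,X)=0$, with $Y$ the vertical extension of $v$, along $u$.
Pairing with the horizontal `X` makes the projection in the second fundamental form invisible. -/
theorem IsRiemannianSubmersion.inner_secondFundamentalForm (hs : IsRiemannianSubmersion pr g gN)
    {X : Π x : M, TangentSpace 𝓘(ℝ, E) x} (hX : MDiffAt (T% X) x)
    (hXh : ∀ᶠ y in 𝓝 x, X y ∈ horizontalSpace (F := F) g pr y) (u : TangentSpace 𝓘(ℝ, E) x)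
    {v : TangentSpace 𝓘(ℝ, E) x} (hv : v ∈ verticalSpace (F := F) pr x) :
    g.inner x (secondFundamentalForm (F := F) g pr x u v) (X x) =
      -g.inner x (leviCivita g X x u) v := by
  have h := leviCivita_metric_apply g (hs.mdifferentiableAt_verticalExtend v) hX u
  have h0 : (fun y => g.inner y (verticalExtend (F := F) g pr v y) (X y)) =ᶠ[𝓝 x] fun _ => 0 := by
    filter_upwards [hXh] with y hy
    exact inner_vertical_horizontal (verticalExtend_mem g pr v y) hy
  rw [h0.mvfderiv_eq, mvfderiv_const, verticalExtend_self hv, zero_apply] at h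
  rw [secondFundamentalForm, inner_horizontalProj_left hXh.self_of_nhds,
    g.symm x (leviCivita g X x u) v]
  linarith

/-- The mean curvature of the fibers in terms of the vertical divergence of horizontal fields. -/
theorem IsRiemannianSubmersion.inner_meanCurvature (hs : IsRiemannianSubmersion pr g gN)
    {X : Π x : M, TangentSpace 𝓘(ℝ, E) x} (hX : MDiffAt (T% X) x)
    (hXh : ∀ᶠ y in 𝓝 x, X y ∈ horizontalSpace (F := F) g pr y) :
    g.inner x (meanCurvature (F := F) g pr x) (X x) = -verticalDiv (F := F) g pr X x := by
  rw [meanCurvature, map_sum, sum_apply, verticalDiv, ← Finset.sum_neg_distrib]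
  exact Finset.sum_congr rfl fun a _ =>
    hs.inner_secondFundamentalForm hX hXh _ (verticalBasis_mem (F := F) g pr x a)

/-- In the Koszul formula with first and third arguments `Y`, the two derivatives of $g(X,Y)$
cancel. If `Y` and the bracket are vertical, what remains involves only the metric along the fibers.
-/
theorem inner_leviCivita_self (g : SmoothMetric E M) {X Y : Π x : M, TangentSpace 𝓘(ℝ, E) x}
    (hX : MDiffAt (T% X) x) (hY : MDiffAt (T% Y) x) :
    g.inner x (leviCivita g X x (Y x)) (Y x) =
      1 / 2 * mvfderiv 𝓘(ℝ, E) (fun y => g.inner y (Y y) (Y y)) x (X x) +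
        g.inner x (mlieBracket 𝓘(ℝ, E) Y X x) (Y x) := by
  have h := inner_leviCivitaFun g hY hX hY
  have h3 : (fun y => g.inner y (X y) (Y y)) = fun y => g.inner y (Y y) (X y) :=
    funext fun y => g.symm y _ _
  rw [koszul, h3, mlieBracket_swap_apply (V := X) (W := Y)] at h
  change g.inner x (leviCivitaFun g X x (Y x)) (Y x) = _
  rw [h]
  simp only [mlieBracket_self, Pi.zero_apply, map_zero, map_neg, neg_apply, zero_apply]
  ring

/-- The vertical divergence of a projectable field depends only on the metric of the fibers. -/
theorem IsRiemannianSubmersion.verticalDiv_congr (hs : IsRiemannianSubmersion pr g gN)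
    (hgg' : ∀ y, ∀ u ∈ verticalSpace (F := F) pr y, ∀ v ∈ verticalSpace (F := F) pr y,
      g'.inner y u v = g.inner y u v)
    {X : Π x : M, TangentSpace 𝓘(ℝ, E) x} {W : Π y : N, TangentSpace 𝓘(ℝ, F) y}
    (hX : MDiffAt (T% X) x) (hW : MDiffAt (T% W) (pr x))
    (hXW : ∀ᶠ y in 𝓝 x, mfderiv 𝓘(ℝ, E) 𝓘(ℝ, F) pr y (X y) = W (pr y)) :
    verticalDiv (F := F) g' pr X x = verticalDiv (F := F) g pr X x := by
  have hb := verticalBasis_congr (F := F) (pr := pr) (x := x) (hgg' x)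
  simp only [verticalDiv, hb]
  refine Finset.sum_congr rfl fun a _ => ?_
  let e : TangentSpace 𝓘(ℝ, E) x := (verticalBasis (F := F) g pr x a).1
  have he : e ∈ verticalSpace (F := F) pr x := verticalBasis_mem (F := F) g pr x a
  have hY := hs.mdifferentiableAt_verticalExtend e
  have hYV : ∀ y, verticalExtend (F := F) g pr e y ∈ verticalSpace (F := F) pr y :=
    verticalExtend_mem g pr e
  have hbr := mlieBracket_mem_verticalSpace (hs.contMDiff x) hY hX hW
    (Filter.Eventually.of_forall hYV) hXW
  have h1 := inner_leviCivita_self g' hX hY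
  have h2 := inner_leviCivita_self g hX hY
  -- Every scalar product left in the expression for `g'` is between vertical vectors, where it
  -- agrees with `g`.
  simp only [hgg' _ _ (hYV _) _ (hYV _), hgg' _ _ hbr _ (hYV _)] at h1
  rw [← h2, verticalExtend_self he] at h1
  exact h1

/-- Metric compatibility moves the covariant derivative off `X`: what remains is the differential of
a scalar function and a term in the value `X x` alone. Both can be differentiated in a parameter. -/
theorem IsRiemannianSubmersion.verticalDiv_eq_sum (hs : IsRiemannianSubmersion pr g gN)
    {X : Π x : M, TangentSpace 𝓘(ℝ, E) x} (hX : MDiffAt (T% X) x) :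
    verticalDiv (F := F) g pr X x = ∑ a,
      (mvfderiv 𝓘(ℝ, E) (fun y => g.inner y (X y)
          (verticalExtend (F := F) g pr (verticalBasis (F := F) g pr x a).1 y)) x
          (verticalBasis (F := F) g pr x a) -
        g.inner x (X x) (leviCivita g
          (verticalExtend (F := F) g pr (verticalBasis (F := F) g pr x a).1) x
          (verticalBasis (F := F) g pr x a))) := by
  refine Finset.sum_congr rfl fun a _ => ?_
  rw [leviCivita_metric_apply g hX (hs.mdifferentiableAt_verticalExtend _),
    verticalExtend_self (verticalBasis_mem (F := F) g pr x a)]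
  ring

theorem verticalDiv_add {X Y : Π x : M, TangentSpace 𝓘(ℝ, E) x}
    (hX : MDiffAt (T% X) x) (hY : MDiffAt (T% Y) x) :
    verticalDiv (F := F) g pr (X + Y) x =
      verticalDiv (F := F) g pr X x + verticalDiv (F := F) g pr Y x := by
  have h : leviCivita g (X + Y) x = leviCivita g X x + leviCivita g Y x :=
    (leviCivita g).isCovariantDerivativeOnUniv.add hX hY (Set.mem_univ x)
  simp only [verticalDiv, h, add_apply, map_add, Finset.sum_add_distrib]

/-- The Leibniz term contains only derivatives of `f` along the fiber, which vanish. -/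
theorem verticalDiv_smul {X : Π x : M, TangentSpace 𝓘(ℝ, E) x} {f : M → ℝ}
    (hf : MDifferentiableAt 𝓘(ℝ, E) 𝓘(ℝ, ℝ) f x) (hX : MDiffAt (T% X) x)
    (hfV : ∀ v ∈ verticalSpace (F := F) pr x, mvfderiv 𝓘(ℝ, E) f x v = 0) :
    verticalDiv (F := F) g pr (f • X) x = f x * verticalDiv (F := F) g pr X x := by
  have h := (leviCivita g).isCovariantDerivativeOnUniv.leibniz hX hf (Set.mem_univ x)
  have h' : ∀ a, leviCivita g (f • X) x (verticalBasis (F := F) g pr x a) =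
      f x • leviCivita g X x (verticalBasis (F := F) g pr x a) := by
    intro a
    refine (congrArg (fun L => L (verticalBasis (F := F) g pr x a : TangentSpace 𝓘(ℝ, E) x))
        h).trans ?_
    simp only [add_apply, ContinuousLinearMap.smulRight_apply,
      hfV _ (verticalBasis_mem (F := F) g pr x a), zero_smul, add_zero]
    rfl
  simp only [verticalDiv, h', map_smul, smul_apply, smul_eq_mul, Finset.mul_sum]

theorem verticalDiv_zero : verticalDiv (F := F) g pr 0 x = 0 := by
  simp [verticalDiv, CovariantDerivative.zero]

/-- Differentiability of the partial sum is carried through the induction, since additivity of the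
divergence needs it at each step. -/
theorem verticalDiv_sum {ι : Type*} (s : Finset ι) {X : ι → Π x : M, TangentSpace 𝓘(ℝ, E) x}
    (hX : ∀ i ∈ s, MDiffAt (T% (X i)) x) :
    MDiffAt (T% (∑ i ∈ s, X i)) x ∧
    verticalDiv (F := F) g pr (∑ i ∈ s, X i) x = ∑ i ∈ s, verticalDiv (F := F) g pr (X i) x := by
  classical
  induction s using Finset.induction_on with
  | empty =>
    refine ⟨?_, by simp [verticalDiv_zero]⟩
    rw [Finset.sum_empty]
    exact mdifferentiable_zeroSection (IB := 𝓘(ℝ, E)) (F := E) ℝ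
        (TangentSpace 𝓘(ℝ, E) : M → Type _) x
  | insert a s ha ih =>
    have h1 := hX a (Finset.mem_insert_self a s)
    obtain ⟨h2, h3⟩ := ih fun i hi => hX i (Finset.mem_insert_of_mem hi)
    rw [Finset.sum_insert ha, Finset.sum_insert ha, ← h3]
    exact ⟨mdifferentiableAt_add_section h1 h2, verticalDiv_add h1 h2⟩

/-- Functions pulled back from the base are constant along the fibers. -/
theorem mvfderiv_comp_of_mem_verticalSpace {f : N → ℝ}
    (hf : MDifferentiableAt 𝓘(ℝ, F) 𝓘(ℝ, ℝ) f (pr x))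
    (hpr : MDifferentiableAt 𝓘(ℝ, E) 𝓘(ℝ, F) pr x) {v : TangentSpace 𝓘(ℝ, E) x}
    (hv : v ∈ verticalSpace (F := F) pr x) :
    mvfderiv 𝓘(ℝ, E) (fun y => f (pr y)) x v = 0 := by
  have h := mvfderiv_comp (I := 𝓘(ℝ, F)) (I' := 𝓘(ℝ, E)) x hf hpr
  change mvfderiv 𝓘(ℝ, E) (f ∘ pr) x v = 0
  rw [h, ContinuousLinearMap.comp_apply, mem_verticalSpace.1 hv, map_zero]

theorem IsRiemannianSubmersion.inner_meanCurvature_horizontalLift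
    (hs : IsRiemannianSubmersion pr g gN) {W : Π y : N, TangentSpace 𝓘(ℝ, F) y}
    (hW : CMDiffAt ∞ (T% W) (pr x)) :
    g.inner x (meanCurvature (F := F) g pr x) (horizontalLift g pr x (W (pr x))) =
      -verticalDiv (F := F) g pr (fun y => horizontalLift g pr y (W (pr y))) x :=
  hs.inner_meanCurvature (X := fun y => horizontalLift g pr y (W (pr y)))
    ((hs.contMDiffAt_horizontalLift_field hW).mdifferentiableAt (by simp))
    (Filter.Eventually.of_forall fun _ => horizontalLift_mem _)

/-- The fibers are minimal if and only if horizontal lifts have vanishing vertical divergence. -/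
theorem IsRiemannianSubmersion.hasMinimalFibers_iff (hs : IsRiemannianSubmersion pr g gN) :
    HasMinimalFibers (F := F) g pr ↔ ∀ (x : M) (W : Π y : N, TangentSpace 𝓘(ℝ, F) y),
      CMDiffAt ∞ (T% W) (pr x) →
        verticalDiv (F := F) g pr (fun y => horizontalLift g pr y (W (pr y))) x = 0 := by
  refine ⟨fun h x W hW => ?_, fun h x => ?_⟩
  · have h1 := hs.inner_meanCurvature_horizontalLift hW
    rw [h x, map_zero, zero_apply] at h1
    linarith
  · let w := mfderiv 𝓘(ℝ, E) 𝓘(ℝ, F) pr x (meanCurvature (F := F) g pr x)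
    let W := FiberBundle.extend F (E := (TangentSpace 𝓘(ℝ, F) : N → Type _)) w
    have hW : CMDiffAt ∞ (T% W) (pr x) := FiberBundle.contMDiffAt_extend 𝓘(ℝ, F) F w
    have h1 := hs.inner_meanCurvature_horizontalLift hW
    have hWx : W (pr x) = w := FiberBundle.extend_apply_self F w
    rw [h x W hW, hWx, hs.horizontalLift_mfderiv,
      horizontalProj_of_mem (meanCurvature_mem g pr x), neg_zero] at h1
    by_contra hne
    exact (g.pos x _ hne).ne' h1

/-- The vertical divergence of the difference of horizontal lifts for two metrics that agree on
the fibers. -/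
theorem IsRiemannianSubmersion.verticalDiv_horizontalLift
    (hs : IsRiemannianSubmersion pr g gN) (hs' : IsRiemannianSubmersion pr g' gN)
    (hgg' : ∀ y, ∀ u ∈ verticalSpace (F := F) pr y, ∀ v ∈ verticalSpace (F := F) pr y,
      g'.inner y u v = g.inner y u v)
    {W : Π y : N, TangentSpace 𝓘(ℝ, F) y} (hW : CMDiffAt ∞ (T% W) (pr x)) :
    verticalDiv (F := F) g' pr (fun y => horizontalLift g' pr y (W (pr y))) x =
      verticalDiv (F := F) g pr (fun y => horizontalLift g pr y (W (pr y))) x +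
        verticalDiv (F := F) g pr
          (fun y => horizontalLift g' pr y (W (pr y)) - horizontalLift g pr y (W (pr y))) x := by
  have h' := (hs'.contMDiffAt_horizontalLift_field hW).mdifferentiableAt (n := ∞) (by simp)
  have h := (hs.contMDiffAt_horizontalLift_field hW).mdifferentiableAt (n := ∞) (by simp)
  have h1 := verticalDiv_add (F := F) (g := g) (pr := pr) h (mdifferentiableAt_sub_section h' h)
  rw [add_sub_cancel] at h1
  -- The `g'`-lift is projectable, so its divergence may be computed with `g`, where it splits as
  -- the `g`-lift plus the vertical difference.
  rw [hs.verticalDiv_congr hgg' h' (hW.mdifferentiableAt (by simp))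
    (Filter.Eventually.of_forall fun y => hs'.mfderiv_horizontalLift g' _)]
  exact h1

end MeanCurvature

/-! ### Submersion metrics with a fixed metric on the fibers -/

section Variations

variable {E : Type*} [NormedAddCommGroup E] [NormedSpace ℝ E] [FiniteDimensional ℝ E]
  {M : Type*} [TopologicalSpace M] [ChartedSpace E M] [IsManifold 𝓘(ℝ, E) ∞ M]
  {F : Type*} [NormedAddCommGroup F] [NormedSpace ℝ F] [FiniteDimensional ℝ F]
  {N : Type*} [TopologicalSpace N] [ChartedSpace F N] [IsManifold 𝓘(ℝ, F) ∞ N]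
  {pr : M → N} {g g' g₀ : SmoothMetric E M} {gN : SmoothMetric F N} {x : M}

theorem smoothMetric_ext
    (h : ∀ x (u v : TangentSpace 𝓘(ℝ, E) x), g.inner x u v = g'.inner x u v) : g = g' := by
  have h1 : g.inner = g'.inner := by
    funext x
    ext u v
    exact h x u v
  cases g
  cases g'
  congr

/-! ### From two metrics to a divergence-free field -/

section DivergenceFreeField

/-- Mixed terms vanish and horizontal parts are measured on `N`. With the fiber metric fixed, the
metric can vary only through its vertical projection, that is, through its lifts. -/
theorem IsRiemannianSubmersion.inner_eq (hs : IsRiemannianSubmersion pr g gN)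
    (u v : TangentSpace 𝓘(ℝ, E) x) :
    g.inner x u v = g.inner x (verticalProj (F := F) g pr x u) (verticalProj (F := F) g pr x v) +
      gN.inner (pr x) (mfderiv 𝓘(ℝ, E) 𝓘(ℝ, F) pr x u) (mfderiv 𝓘(ℝ, E) 𝓘(ℝ, F) pr x v) := by
  conv_lhs => rw [← verticalProj_add_horizontalProj (F := F) g pr x u,
    ← verticalProj_add_horizontalProj (F := F) g pr x v]
  simp only [map_add, add_apply]
  rw [inner_vertical_horizontal (verticalProj_mem (F := F) g pr x u)
      (horizontalProj_mem (F := F) g pr x v),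
    inner_horizontal_vertical (horizontalProj_mem (F := F) g pr x u)
      (verticalProj_mem (F := F) g pr x v),
    hs.isometry x _ (horizontalProj_mem (F := F) g pr x u) _ (horizontalProj_mem (F := F) g pr x v),
    mfderiv_horizontalProj, mfderiv_horizontalProj]
  ring

/-- A submersion metric is determined by its restriction to the fibers and its horizontal lifts. -/
theorem IsRiemannianSubmersion.eq_of_horizontalLift_eq
    (hs : IsRiemannianSubmersion pr g gN) (hs' : IsRiemannianSubmersion pr g' gN)
    (hgg' : ∀ y, ∀ u ∈ verticalSpace (F := F) pr y, ∀ v ∈ verticalSpace (F := F) pr y,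
      g'.inner y u v = g.inner y u v)
    (hlift : ∀ x (w : TangentSpace 𝓘(ℝ, F) (pr x)),
      horizontalLift g' pr x w = horizontalLift g pr x w) : g' = g := by
  refine smoothMetric_ext fun x u v => ?_
  have hV : ∀ u : TangentSpace 𝓘(ℝ, E) x,
      verticalProj (F := F) g' pr x u = verticalProj (F := F) g pr x u := by
    intro u
    rw [eq_sub_of_add_eq (verticalProj_add_horizontalProj (F := F) g' pr x u),
      eq_sub_of_add_eq (verticalProj_add_horizontalProj (F := F) g pr x u),
      ← hs.horizontalLift_mfderiv, ← hs'.horizontalLift_mfderiv, hlift]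
  rw [hs.inner_eq, hs'.inner_eq, hV, hV,
    hgg' x _ (verticalProj_mem (F := F) g pr x u) _ (verticalProj_mem (F := F) g pr x v)]

/-- Two different submersion metrics with minimal fibers which agree on the fibers give a
vertical field that is divergence-free along the fibers. -/
theorem IsRiemannianSubmersion.exists_divergenceFree [T2Space N]
    (hs : IsRiemannianSubmersion pr g gN) (hs' : IsRiemannianSubmersion pr g' gN)
    (hgg' : ∀ y, ∀ u ∈ verticalSpace (F := F) pr y, ∀ v ∈ verticalSpace (F := F) pr y,
      g'.inner y u v = g.inner y u v)
    (hmin : HasMinimalFibers (F := F) g pr) (hmin' : HasMinimalFibers (F := F) g' pr)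
    (hne : g' ≠ g) :
    ∃ ξ : Π x : M, TangentSpace 𝓘(ℝ, E) x, CMDiff ∞ (T% ξ) ∧
      (∀ x, ξ x ∈ verticalSpace (F := F) pr x) ∧ (∃ x, ξ x ≠ 0) ∧
      ∀ x, verticalDiv (F := F) g pr ξ x = 0 := by
  obtain ⟨x, w, hxw⟩ : ∃ x, ∃ w : TangentSpace 𝓘(ℝ, F) (pr x),
      horizontalLift g' pr x w ≠ horizontalLift g pr x w := by
    by_contra! h
    exact hne (hs.eq_of_horizontalLift_eq hs' hgg' h)
  -- Extending `w` to all of `N` makes the difference of the two lifts a global vertical field,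
  -- non-zero at `x`.
  obtain ⟨W, hW, hWw⟩ := exists_contMDiff_vectorField w
  refine ⟨fun y => horizontalLift g' pr y (W (pr y)) - horizontalLift g pr y (W (pr y)),
    fun y => ?_, fun y => ?_, ⟨x, ?_⟩, fun y => ?_⟩
  · exact (hs'.contMDiffAt_horizontalLift_field (hW (pr y))).sub_section
      (hs.contMDiffAt_horizontalLift_field (hW (pr y)))
  · rw [mem_verticalSpace, map_sub, hs.mfderiv_horizontalLift, hs.mfderiv_horizontalLift, sub_self]
  · simpa only [hWw, ne_eq, sub_eq_zero] using hxw
  · have h := hs.verticalDiv_horizontalLift hs' hgg' (hW (pr y))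
    rw [hs.hasMinimalFibers_iff.1 hmin y W (hW (pr y)),
      hs'.hasMinimalFibers_iff.1 hmin' y W (hW (pr y)), zero_add] at h
    exact h.symm

end DivergenceFreeField

/-! ### Shearing a metric along a vertical field -/

section Shear

variable (g₀) in
/-- The pullback of `g₀` under the shear `u ↦ u - t g₀(Z, u) ξ`, as a bilinear form. -/
def shearInner (Z ξ : Π x : M, TangentSpace 𝓘(ℝ, E) x) (t : ℝ) (x : M) :
    TangentSpace 𝓘(ℝ, E) x →L[ℝ] TangentSpace 𝓘(ℝ, E) x →L[ℝ] ℝ :=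
  g₀.inner x - t • ((g₀.inner x (Z x)).smulRight (g₀.inner x (ξ x)) +
      (g₀.inner x (ξ x)).smulRight (g₀.inner x (Z x))) +
    (t ^ 2 * g₀.inner x (ξ x) (ξ x)) • (g₀.inner x (Z x)).smulRight (g₀.inner x (Z x))

/-- This polynomial in `t` with coefficients smooth in `x` serves for joint smoothness; the pullback
form serves for positivity. -/
theorem shearInner_apply (Z ξ : Π x : M, TangentSpace 𝓘(ℝ, E) x) (t : ℝ)
    (u v : TangentSpace 𝓘(ℝ, E) x) :
    shearInner g₀ Z ξ t x u v = g₀.inner x u v - t * (g₀.inner x (Z x) u * g₀.inner x (ξ x) v +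
        g₀.inner x (ξ x) u * g₀.inner x (Z x) v) +
      t ^ 2 * (g₀.inner x (ξ x) (ξ x) * (g₀.inner x (Z x) u * g₀.inner x (Z x) v)) := by
  change g₀.inner x u v - t * (g₀.inner x (Z x) u * g₀.inner x (ξ x) v +
        g₀.inner x (ξ x) u * g₀.inner x (Z x) v) +
      t ^ 2 * g₀.inner x (ξ x) (ξ x) * (g₀.inner x (Z x) u * g₀.inner x (Z x) v) = _
  ring

theorem shearInner_eq (Z ξ : Π x : M, TangentSpace 𝓘(ℝ, E) x) (t : ℝ)
    (u v : TangentSpace 𝓘(ℝ, E) x) :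
    shearInner g₀ Z ξ t x u v = g₀.inner x (u - (t * g₀.inner x (Z x) u) • ξ x)
      (v - (t * g₀.inner x (Z x) v) • ξ x) := by
  rw [shearInner_apply]
  simp only [map_sub, map_smul, sub_apply, smul_apply, smul_eq_mul]
  rw [g₀.symm x u (ξ x)]
  ring

theorem contMDiffAt_inner {Y Y' : Π x : M, TangentSpace 𝓘(ℝ, E) x} (g : SmoothMetric E M)
    (hY : CMDiffAt ∞ (T% Y) x) (hY' : CMDiffAt ∞ (T% Y') x) :
    ContMDiffAt 𝓘(ℝ, E) 𝓘(ℝ, ℝ) ∞ (fun y => g.inner y (Y y) (Y' y)) x :=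
  contMDiffAt_bilin_apply (b := id) (g.contMDiff x) hY hY'

theorem contMDiffAt_shearInner {Z ξ : Π x : M, TangentSpace 𝓘(ℝ, E) x}
    (hZ : CMDiff ∞ (T% Z)) (hξ : CMDiff ∞ (T% ξ)) (p : ℝ × M) :
    ContMDiffAt (𝓘(ℝ, ℝ).prod 𝓘(ℝ, E)) (𝓘(ℝ, E).prod 𝓘(ℝ, E →L[ℝ] E →L[ℝ] ℝ)) ∞
      (fun p : ℝ × M => TotalSpace.mk' (E →L[ℝ] E →L[ℝ] ℝ)
        (E := fun x : M => TangentSpace 𝓘(ℝ, E) x →L[ℝ] TangentSpace 𝓘(ℝ, E) x →L[ℝ] ℝ)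
        p.2 (shearInner g₀ Z ξ p.1 p.2)) p := by
  refine contMDiffAt_bilin_of_apply_extend (b := Prod.snd) contMDiffAt_snd fun u v => ?_
  simp only [shearInner_apply]
  have hu : CMDiffAt ∞ (T% (FiberBundle.extend E (E := (TangentSpace 𝓘(ℝ, E) : M → Type _)) u))
      p.2 :=
    FiberBundle.contMDiffAt_extend 𝓘(ℝ, E) E u
  have hv : CMDiffAt ∞ (T% (FiberBundle.extend E (E := (TangentSpace 𝓘(ℝ, E) : M → Type _)) v))
      p.2 :=
    FiberBundle.contMDiffAt_extend 𝓘(ℝ, E) E v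
  have hsnd : ContMDiffAt (𝓘(ℝ, ℝ).prod 𝓘(ℝ, E)) 𝓘(ℝ, E) ∞ (Prod.snd : ℝ × M → M) p :=
    contMDiffAt_snd
  have hfst : ContMDiffAt (𝓘(ℝ, ℝ).prod 𝓘(ℝ, E)) 𝓘(ℝ, ℝ) ∞ (Prod.fst : ℝ × M → ℝ) p :=
    contMDiffAt_fst
  have hZu := (contMDiffAt_inner g₀ (hZ p.2) hu).comp p hsnd
  have hZv := (contMDiffAt_inner g₀ (hZ p.2) hv).comp p hsnd
  have hξu := (contMDiffAt_inner g₀ (hξ p.2) hu).comp p hsnd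
  have hξv := (contMDiffAt_inner g₀ (hξ p.2) hv).comp p hsnd
  have hξξ := (contMDiffAt_inner g₀ (hξ p.2) (hξ p.2)).comp p hsnd
  have huv := (contMDiffAt_inner g₀ hu hv).comp p hsnd
  exact (huv.sub (hfst.mul ((hZu.mul hξv).add (hξu.mul hZv)))).add
    ((hfst.pow 2).mul (hξξ.mul (hZu.mul hZv)))

/-- The pullback of `g₀` under the shear `u ↦ u - t g₀(Z, u) ξ`, for `g₀`-orthogonal vector
fields `Z` and `ξ`. -/
def shearMetric (g₀ : SmoothMetric E M) {Z ξ : Π x : M, TangentSpace 𝓘(ℝ, E) x}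
    (hZ : CMDiff ∞ (T% Z)) (hξ : CMDiff ∞ (T% ξ)) (hZξ : ∀ x, g₀.inner x (Z x) (ξ x) = 0)
    (t : ℝ) : SmoothMetric E M where
  inner x := shearInner g₀ Z ξ t x
  symm x u v := by rw [shearInner_eq, shearInner_eq, g₀.symm]
  pos x u hu := by
    rw [shearInner_eq]
    -- If the shear kills `u`, pairing with `Z`, which is orthogonal to `ξ`, gives $g_0(Z,u)=0$, and
    -- then the shear fixes `u`.
    refine g₀.pos x _ fun h => hu ?_
    have h1 := congrArg (g₀.inner x (Z x)) h
    simp only [map_sub, map_smul, hZξ, smul_zero, sub_zero, map_zero] at h1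
    simpa [h1] using h
  isVonNBounded x := by
    -- The inverse shear $u\mapsto u+t\,g_0(Z,u)\,\xi$ is linear and continuous, and maps the unit
    -- ball of $g_0$ onto that of the new metric.
    have h := (g₀.isVonNBounded x).image
      (ContinuousLinearMap.id ℝ _ + t • (g₀.inner x (Z x)).smulRight (ξ x))
    refine h.subset fun v hv => ?_
    refine ⟨v - (t * g₀.inner x (Z x) v) • ξ x, ?_, ?_⟩
    · rw [Set.mem_ofPred_eq, shearInner_eq] at hv
      exact hv
    · simp [hZξ, smul_smul]
  contMDiff x := by
    have h : ContMDiffAt 𝓘(ℝ, E) (𝓘(ℝ, ℝ).prod 𝓘(ℝ, E)) ∞ (fun y : M => (t, y)) x :=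
      contMDiffAt_const.prodMk contMDiffAt_id
    exact (contMDiffAt_shearInner hZ hξ (t, x)).comp x h

variable {Z ξ : Π x : M, TangentSpace 𝓘(ℝ, E) x}
  (hZ : CMDiff ∞ (T% Z)) (hξ : CMDiff ∞ (T% ξ)) (hZξ : ∀ x, g₀.inner x (Z x) (ξ x) = 0)

theorem shearMetric_inner (t : ℝ) (u v : TangentSpace 𝓘(ℝ, E) x) :
    (shearMetric g₀ hZ hξ hZξ t).inner x u v =
      g₀.inner x (u - (t * g₀.inner x (Z x) u) • ξ x) (v - (t * g₀.inner x (Z x) v) • ξ x) :=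
  shearInner_eq Z ξ t u v

/-- As `Z` is horizontal, the shear fixes vertical vectors; in particular the metric of the fibers
does not change. -/
theorem shearMetric_inner_vertical (hZH : ∀ x, Z x ∈ horizontalSpace (F := F) g₀ pr x) (t : ℝ)
    {u : TangentSpace 𝓘(ℝ, E) x} (hu : u ∈ verticalSpace (F := F) pr x)
    (v : TangentSpace 𝓘(ℝ, E) x) :
    (shearMetric g₀ hZ hξ hZξ t).inner x u v =
      g₀.inner x u (v - (t * g₀.inner x (Z x) v) • ξ x) := by
  rw [shearMetric_inner, inner_horizontal_vertical (hZH x) hu, mul_zero, zero_smul, sub_zero]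

theorem isVariation_shearMetric (hZH : ∀ x, Z x ∈ horizontalSpace (F := F) g₀ pr x) :
    IsVariation (F := F) pr g₀ 1 (shearMetric g₀ hZ hξ hZξ) where
  pos := one_pos
  zero := smoothMetric_ext fun x u v => by simp [shearMetric_inner]
  smooth p _ := (contMDiffAt_shearInner hZ hξ p).contMDiffWithinAt
  vertical t _ x u hu v hv := by
    rw [shearMetric_inner_vertical hZ hξ hZξ hZH t hu, inner_horizontal_vertical (hZH x) hv,
      mul_zero, zero_smul, sub_zero]

theorem mem_horizontalSpace_shearMetric (hZH : ∀ x, Z x ∈ horizontalSpace (F := F) g₀ pr x) (t : ℝ)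
    {u : TangentSpace 𝓘(ℝ, E) x} :
    u ∈ horizontalSpace (F := F) (shearMetric g₀ hZ hξ hZξ t) pr x ↔
      u - (t * g₀.inner x (Z x) u) • ξ x ∈ horizontalSpace (F := F) g₀ pr x := by
  rw [mem_horizontalSpace, mem_horizontalSpace]
  exact forall₂_congr fun v hv => by rw [shearMetric_inner_vertical hZ hξ hZξ hZH t hv]

/-- The shear maps new horizontal vectors to old ones and moves them by multiples of the vertical
`ξ`, so their projections to `N` are unchanged. -/
theorem IsRiemannianSubmersion.shearMetric (hs : IsRiemannianSubmersion pr g₀ gN)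
    (hZH : ∀ x, Z x ∈ horizontalSpace (F := F) g₀ pr x)
    (hξV : ∀ x, ξ x ∈ verticalSpace (F := F) pr x) (t : ℝ) :
    IsRiemannianSubmersion pr (shearMetric g₀ hZ hξ hZξ t) gN where
  contMDiff := hs.contMDiff
  surjective := hs.surjective
  isometry x u hu v hv := by
    rw [mem_horizontalSpace_shearMetric hZ hξ hZξ hZH] at hu hv
    rw [shearMetric_inner, hs.isometry x _ hu _ hv]
    simp only [map_sub, map_smul, mem_verticalSpace.1 (hξV x), smul_zero, sub_zero]

/-- The inverse shear of the old lift is horizontal for the new metric and has the same projection.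
-/
theorem IsRiemannianSubmersion.horizontalLift_shearMetric (hs : IsRiemannianSubmersion pr g₀ gN)
    (hZH : ∀ x, Z x ∈ horizontalSpace (F := F) g₀ pr x)
    (hξV : ∀ x, ξ x ∈ verticalSpace (F := F) pr x) (t : ℝ) (w : TangentSpace 𝓘(ℝ, F) (pr x)) :
    horizontalLift (_root_.shearMetric g₀ hZ hξ hZξ t) pr x w = horizontalLift g₀ pr x w +
      (t * g₀.inner x (Z x) (horizontalLift g₀ pr x w)) • ξ x := by
  refine (hs.shearMetric hZ hξ hZξ hZH hξV t).eq_horizontalLift ?_ ?_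
  · rw [mem_horizontalSpace_shearMetric hZ hξ hZξ hZH]
    simp only [map_add, map_smul, hZξ, smul_zero, add_zero, add_sub_cancel_right]
    exact horizontalLift_mem w
  · rw [map_add, map_smul, mem_verticalSpace.1 (hξV x), smul_zero, add_zero,
      hs.mfderiv_horizontalLift]

theorem IsRiemannianSubmersion.hasMinimalFibers_shearMetric
    (hs : IsRiemannianSubmersion pr g₀ gN) (hmin : HasMinimalFibers (F := F) g₀ pr)
    {Q : Π y : N, TangentSpace 𝓘(ℝ, F) y} (hQ : CMDiff ∞ (T% Q))
    (hZQ : ∀ x, Z x = horizontalLift g₀ pr x (Q (pr x)))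
    (hξV : ∀ x, ξ x ∈ verticalSpace (F := F) pr x)
    (hdiv : ∀ x, verticalDiv (F := F) g₀ pr ξ x = 0) (t : ℝ) :
    HasMinimalFibers (F := F) (_root_.shearMetric g₀ hZ hξ hZξ t) pr := by
  have hZH : ∀ x, Z x ∈ horizontalSpace (F := F) g₀ pr x := fun x => by
    rw [hZQ]; exact horizontalLift_mem _
  have hs' := hs.shearMetric hZ hξ hZξ hZH hξV t
  have hgg' : ∀ y, ∀ u ∈ verticalSpace (F := F) pr y, ∀ v ∈ verticalSpace (F := F) pr y,
      (_root_.shearMetric g₀ hZ hξ hZξ t).inner y u v = g₀.inner y u v := fun y u hu v hv => by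
    rw [shearMetric_inner_vertical hZ hξ hZξ hZH t hu, inner_horizontal_vertical (hZH y) hv,
      mul_zero, zero_smul, sub_zero]
  rw [hs'.hasMinimalFibers_iff]
  intro x W hW
  rw [hs.verticalDiv_horizontalLift hs' hgg' hW, hs.hasMinimalFibers_iff.1 hmin x W hW, zero_add]
  -- As `Z` is the lift of `Q`, the coefficient of `ξ` in the change of the lift of `W` is
  -- $t\,g_N(Q,W)$ pulled back from `N`, so it passes through the vertical divergence.
  let f : N → ℝ := fun z => t * gN.inner z (Q z) (W z)
  have hf : MDifferentiableAt 𝓘(ℝ, F) 𝓘(ℝ, ℝ) f (pr x) :=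
    (contMDiffAt_const.mul (contMDiffAt_inner gN (hQ (pr x)) hW)).mdifferentiableAt
      (n := ∞) (by simp)
  have heq : (fun y => horizontalLift (_root_.shearMetric g₀ hZ hξ hZξ t) pr y (W (pr y)) -
      horizontalLift g₀ pr y (W (pr y))) = (fun y => f (pr y)) • ξ := by
    funext y
    rw [hs.horizontalLift_shearMetric hZ hξ hZξ hZH hξV, add_sub_cancel_left, hZQ,
      hs.inner_horizontalLift, hs.mfderiv_horizontalLift]
    rfl
  rw [heq, verticalDiv_smul (f := fun y => f (pr y)) (hf.comp x (hs.mdifferentiableAt x))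
    ((hξ x).mdifferentiableAt (by simp))
    (fun v hv => mvfderiv_comp_of_mem_verticalSpace hf (hs.mdifferentiableAt x) hv),
    hdiv, mul_zero]

/-- A vertical field that is divergence-free along the fibers gives a variation by submersion
metrics with minimal fibers. -/
theorem IsRiemannianSubmersion.exists_variation [T2Space N]
    (hs : IsRiemannianSubmersion pr g₀ gN) (hmin : HasMinimalFibers (F := F) g₀ pr)
    (hF : 0 < Module.finrank ℝ F) {ξ : Π x : M, TangentSpace 𝓘(ℝ, E) x} (hξ : CMDiff ∞ (T% ξ))
    (hξV : ∀ x, ξ x ∈ verticalSpace (F := F) pr x) (hξ0 : ξ x ≠ 0)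
    (hdiv : ∀ x, verticalDiv (F := F) g₀ pr ξ x = 0) :
    ∃ (ε : ℝ) (g : ℝ → SmoothMetric E M), IsVariation (F := F) pr g₀ ε g ∧
      (∃ t ∈ Set.Ioo (-ε) ε, g t ≠ g₀) ∧
      ∀ t ∈ Set.Ioo (-ε) ε,
        IsRiemannianSubmersion pr (g t) gN ∧ HasMinimalFibers (F := F) (g t) pr := by
  -- Positive dimension of the base provides `Q` with `Q (pr x) ≠ 0`, hence `Z x ≠ 0` at a point
  -- where `ξ` does not vanish.
  have : Nontrivial F := Module.nontrivial_of_finrank_pos hF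
  obtain ⟨w, hw⟩ := exists_ne (0 : F)
  obtain ⟨Q, hQ, hQw⟩ := exists_contMDiff_vectorField (x := pr x) (w : TangentSpace 𝓘(ℝ, F) (pr x))
  let Z : Π x : M, TangentSpace 𝓘(ℝ, E) x := fun y => horizontalLift g₀ pr y (Q (pr y))
  have hZ : CMDiff ∞ (T% Z) := fun y => hs.contMDiffAt_horizontalLift_field (hQ (pr y))
  have hZH : ∀ x, Z x ∈ horizontalSpace (F := F) g₀ pr x := fun y => horizontalLift_mem _
  have hZξ : ∀ x, g₀.inner x (Z x) (ξ x) = 0 := fun y =>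
    inner_horizontal_vertical (hZH y) (hξV y)
  -- The shear is invertible for every `t`, so any `ε > 0` would serve. Likewise any `t ≠ 0` would
  -- show non-triviality: $g_t(\xi,Z)=g_0(\xi,Z)-t\,g_0(Z,Z)\,g_0(\xi,\xi)$.
  refine ⟨1, _root_.shearMetric g₀ hZ hξ hZξ, isVariation_shearMetric hZ hξ hZξ hZH,
    ⟨1 / 2, by norm_num, fun h => ?_⟩, fun t _ => ⟨hs.shearMetric hZ hξ hZξ hZH hξV t,
      hs.hasMinimalFibers_shearMetric hZ hξ hZξ hmin hQ (fun _ => rfl) hξV hdiv t⟩⟩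
  have hZ0 : Z x ≠ 0 := by
    intro h0
    have h1 := hs.mfderiv_horizontalLift g₀ (Q (pr x))
    rw [show horizontalLift g₀ pr x (Q (pr x)) = 0 from h0, map_zero, hQw] at h1
    exact hw h1.symm
  have h1 : (_root_.shearMetric g₀ hZ hξ hZξ (1 / 2)).inner x (ξ x) (Z x) =
      g₀.inner x (ξ x) (Z x) := by rw [h]
  rw [shearMetric_inner_vertical hZ hξ hZξ hZH _ (hξV x), map_sub, map_smul, smul_eq_mul] at h1
  have h2 := g₀.pos x _ hZ0
  have h3 := g₀.pos x _ hξ0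
  have h4 := mul_pos h2 h3
  linarith

end Shear

end Variations

/-! ### First variation of the mean curvature -/

section MeanCurvatureVariation

variable {E : Type*} [NormedAddCommGroup E] [NormedSpace ℝ E] [FiniteDimensional ℝ E]
  {M : Type*} [TopologicalSpace M] [ChartedSpace E M] [IsManifold 𝓘(ℝ, E) ∞ M]
  {F : Type*} [NormedAddCommGroup F] [NormedSpace ℝ F] [FiniteDimensional ℝ F]
  {N : Type*} [TopologicalSpace N] [ChartedSpace F N] [IsManifold 𝓘(ℝ, F) ∞ N]
  {pr : M → N} {g₀ : SmoothMetric E M} {gN : SmoothMetric F N} {x : M}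
  {ε t : ℝ} {g : ℝ → SmoothMetric E M}

theorem IsVariation.contMDiffAt_inner (hvar : IsVariation (F := F) pr g₀ ε g)
    (ht : t ∈ Set.Ioo (-ε) ε) {X Y : Π x : M, TangentSpace 𝓘(ℝ, E) x}
    (hX : CMDiffAt ∞ (T% X) x) (hY : CMDiffAt ∞ (T% Y) x) :
    ContMDiffAt (𝓘(ℝ, ℝ).prod 𝓘(ℝ, E)) 𝓘(ℝ, ℝ) ∞
      (fun p : ℝ × M => (g p.1).inner p.2 (X p.2) (Y p.2)) (t, x) := by
  have hsnd : ContMDiffAt (𝓘(ℝ, ℝ).prod 𝓘(ℝ, E)) 𝓘(ℝ, E) ∞ (Prod.snd : ℝ × M → M) (t, x) :=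
    contMDiffAt_snd
  refine contMDiffAt_bilin_apply (b := Prod.snd) (hvar.smooth.contMDiffAt ?_)
    (ContMDiffAt.comp (t, x) hX hsnd) (ContMDiffAt.comp (t, x) hY hsnd)
  exact prod_mem_nhds (isOpen_Ioo.mem_nhds ht) Filter.univ_mem

theorem IsVariation.hasDerivAt_inner (hvar : IsVariation (F := F) pr g₀ ε g)
    (ht : t ∈ Set.Ioo (-ε) ε) (u v : TangentSpace 𝓘(ℝ, E) x) :
    HasDerivAt (fun s => (g s).inner x u v) (metricVelocity g t x u v) t := by
  have h := hvar.contMDiffAt_inner ht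
    (FiberBundle.contMDiffAt_extend 𝓘(ℝ, E) E (V := (TangentSpace 𝓘(ℝ, E) : M → Type _)) u)
    (FiberBundle.contMDiffAt_extend 𝓘(ℝ, E) E (V := (TangentSpace 𝓘(ℝ, E) : M → Type _)) v)
  have h1 : ContMDiffAt 𝓘(ℝ, ℝ) (𝓘(ℝ, ℝ).prod 𝓘(ℝ, E)) ∞ (fun s : ℝ => (s, x)) t :=
    contMDiffAt_id.prodMk contMDiffAt_const
  have h2 := (h.comp t h1).contDiffAt.differentiableAt (by simp)
  simp only [Function.comp_def, FiberBundle.extend_apply_self] at h2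
  exact h2.hasDerivAt

/-- All metrics of the variation share one orthonormal vertical basis, so removing the vertical part
of the `g₀`-lift leaves `t` only in scalar coefficients. -/
theorem IsVariation.horizontalLift_eq (hvar : IsVariation (F := F) pr g₀ ε g)
    (ht : t ∈ Set.Ioo (-ε) ε) (hs : IsRiemannianSubmersion pr (g t) gN)
    (w : TangentSpace 𝓘(ℝ, F) (pr x)) :
    horizontalLift (g t) pr x w = horizontalLift g₀ pr x w -
      ∑ a, (g t).inner x (horizontalLift g₀ pr x w) (verticalBasis (F := F) g₀ pr x a) •
        (verticalBasis (F := F) g₀ pr x a : TangentSpace 𝓘(ℝ, E) x) := by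
  have hb : verticalBasis (F := F) (g t) pr x = verticalBasis (F := F) g₀ pr x :=
    verticalBasis_congr (hvar.vertical t ht x)
  rw [hs.horizontalLift_eq g₀, ← hb, ← verticalProj_eq_sum, eq_sub_iff_add_eq, add_comm,
    verticalProj_add_horizontalProj]

/-- The lift is linear despite the choice of preimages, because the combination of lifts is
horizontal with the right projection. -/
theorem IsRiemannianSubmersion.horizontalLift_sum_smul {g : SmoothMetric E M}
    (hs : IsRiemannianSubmersion pr g gN) {ι : Type*} (s : Finset ι) (c : ι → ℝ)
    (w : ι → TangentSpace 𝓘(ℝ, F) (pr x)) :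
    horizontalLift g pr x (∑ i ∈ s, c i • w i) = ∑ i ∈ s, c i • horizontalLift g pr x (w i) := by
  refine hs.eq_horizontalLift
    (Submodule.sum_mem _ fun i _ => Submodule.smul_mem _ _ (horizontalLift_mem _)) ?_
  simp only [map_sum, map_smul, hs.mfderiv_horizontalLift]

/-- The expansion of a vector in a basis that is orthonormal for `gN`. -/
theorem sum_inner_formOrthonormalBasis (gN : SmoothMetric F N) {z : N}
    (hQ : (∀ u v, metricForm gN z u v = metricForm gN z v u) ∧
      ∀ v, v ≠ 0 → 0 < metricForm gN z v v) (w : TangentSpace 𝓘(ℝ, F) z) :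
    ∑ j, gN.inner z w (formOrthonormalBasis (metricForm gN z) hQ j) •
      formOrthonormalBasis (metricForm gN z) hQ j = w := by
  set b := formOrthonormalBasis (metricForm gN z) hQ with hb
  have key : ∀ j, gN.inner z w (b j) = b.repr w j := by
    intro j
    have h : ∀ i, gN.inner z (b i) (b j) = if i = j then 1 else 0 := fun i =>
      formOrthonormalBasis_orthonormal (metricForm gN z) hQ i j
    refine (congrArg (fun u => gN.inner z u (b j)) (b.sum_repr w)).symm.trans ?_
    simp only [map_sum, map_smul, sum_apply, smul_apply, h, smul_eq_mul, mul_ite, mul_one,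
      mul_zero, Finset.sum_ite_eq', Finset.mem_univ, if_true]
  simp only [key, b.sum_repr]

section Velocity

variable {k : ℕ} {V : Fin k → Π x : M, TangentSpace 𝓘(ℝ, E) x}
  {W : Fin k → Π y : N, TangentSpace 𝓘(ℝ, F) y}

/-- By symmetry the left side is $g_t(B_t^\sharp u,L_0w)$, where $L_0w$ is the $g_0$-lift. The
vector $P^t_{\mathcal H}\pi^*W_i$ is the $g_t$-lift of $W_i$, so it pairs with $L_0w$ to
$g_N(W_i,w)$. -/
theorem metricVelocity_horizontalLift (hs₀ : IsRiemannianSubmersion pr g₀ gN)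
    (hs : IsRiemannianSubmersion pr (g t) gN) {u : TangentSpace 𝓘(ℝ, E) x}
    (hvel : IsVelocitySharp g t x u
      (∑ i, g₀.inner x (V i x) u •
        horizontalProj (F := F) (g t) pr x (horizontalLift g₀ pr x (W i (pr x)))))
    (w : TangentSpace 𝓘(ℝ, F) (pr x)) :
    metricVelocity g t x (horizontalLift g₀ pr x w) u =
      g₀.inner x (∑ i, gN.inner (pr x) (W i (pr x)) w • V i x) u := by
  have h1 : metricVelocity g t x (horizontalLift g₀ pr x w) u =
      metricVelocity g t x u (horizontalLift g₀ pr x w) := by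
    simp only [metricVelocity, (g _).symm x (horizontalLift g₀ pr x w) u]
  rw [h1, ← hvel]
  simp only [map_sum, map_smul, sum_apply, smul_apply, ← hs.horizontalLift_eq g₀,
    hs.inner_horizontalLift, hs₀.mfderiv_horizontalLift, smul_eq_mul]
  exact Finset.sum_congr rfl fun i _ => mul_comm _ _

/-- The coefficients in `IsVariation.horizontalLift_eq` have derivatives $B_t(L_0w,E_a)=g_0(Y,E_a)$,
with $L_0w$ the $g_0$-lift and $Y=\sum_i g_N(W_i,w)V_i$; being vertical, $Y$ is recovered from them.
-/
theorem IsVariation.hasDerivAt_horizontalLift (hvar : IsVariation (F := F) pr g₀ ε g)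
    (ht : t ∈ Set.Ioo (-ε) ε) (hs₀ : IsRiemannianSubmersion pr g₀ gN)
    (hs : ∀ t ∈ Set.Ioo (-ε) ε, IsRiemannianSubmersion pr (g t) gN)
    (hV : ∀ i, V i x ∈ verticalSpace (F := F) pr x)
    (hvel : ∀ u ∈ verticalSpace (F := F) pr x, IsVelocitySharp g t x u
      (∑ i, g₀.inner x (V i x) u •
        horizontalProj (F := F) (g t) pr x (horizontalLift g₀ pr x (W i (pr x)))))
    (w : TangentSpace 𝓘(ℝ, F) (pr x)) :
    HasDerivAt (F := E) (fun s => horizontalLift (g s) pr x w)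
      (-(∑ i, gN.inner (pr x) (W i (pr x)) w • V i x : TangentSpace 𝓘(ℝ, E) x)) t := by
  set Y : TangentSpace 𝓘(ℝ, E) x := ∑ i, gN.inner (pr x) (W i (pr x)) w • V i x with hY
  have hYV : Y ∈ verticalSpace (F := F) pr x :=
    Submodule.sum_mem _ fun i _ => Submodule.smul_mem _ _ (hV i)
  have h1 : HasDerivAt (F := E) (fun s => horizontalLift g₀ pr x w -
      ∑ a, (g s).inner x (horizontalLift g₀ pr x w) (verticalBasis (F := F) g₀ pr x a) •
        (verticalBasis (F := F) g₀ pr x a : TangentSpace 𝓘(ℝ, E) x))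
      (-∑ a, g₀.inner x Y (verticalBasis (F := F) g₀ pr x a) •
        (verticalBasis (F := F) g₀ pr x a : TangentSpace 𝓘(ℝ, E) x)) t := by
    have h2 : ∀ a, HasDerivAt (F := E) (fun s =>
        (g s).inner x (horizontalLift g₀ pr x w) (verticalBasis (F := F) g₀ pr x a) •
          (verticalBasis (F := F) g₀ pr x a : TangentSpace 𝓘(ℝ, E) x))
        (g₀.inner x Y (verticalBasis (F := F) g₀ pr x a) •
          (verticalBasis (F := F) g₀ pr x a : TangentSpace 𝓘(ℝ, E) x)) t := by
      intro a
      have h3 := hvar.hasDerivAt_inner ht (horizontalLift g₀ pr x w)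
        (verticalBasis (F := F) g₀ pr x a : TangentSpace 𝓘(ℝ, E) x)
      rw [metricVelocity_horizontalLift hs₀ (hs t ht)
        (hvel _ (verticalBasis_mem (F := F) g₀ pr x a))] at h3
      exact h3.smul_const (F := E) _
    exact (HasDerivAt.fun_sum (F := E) (fun a _ => h2 a)).const_sub (F := E) _
  rw [sum_inner_verticalBasis hYV] at h1
  refine h1.congr_of_eventuallyEq ?_
  filter_upwards [isOpen_Ioo.mem_nhds ht] with s hs'
  exact hvar.horizontalLift_eq hs' (hs s hs') w

/-- This isolates the dependence on `t`: the basis, the extensions and the connection belong to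
`g₀`, and `t` enters only through scalar products of fixed fields and through the lift at the single
point `x`. -/
theorem IsVariation.inner_meanCurvature_eq (hvar : IsVariation (F := F) pr g₀ ε g)
    (ht : t ∈ Set.Ioo (-ε) ε) (hs₀ : IsRiemannianSubmersion pr g₀ gN)
    (hs : IsRiemannianSubmersion pr (g t) gN)
    {Q : Π y : N, TangentSpace 𝓘(ℝ, F) y} (hQ : CMDiffAt ∞ (T% Q) (pr x)) :
    (g t).inner x (meanCurvature (F := F) (g t) pr x) (horizontalLift (g t) pr x (Q (pr x))) =
      -verticalDiv (F := F) g₀ pr (fun y => horizontalLift g₀ pr y (Q (pr y))) x +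
      ∑ a, (mvfderiv 𝓘(ℝ, E) (fun y => (g t).inner y (horizontalLift g₀ pr y (Q (pr y)))
          (verticalExtend (F := F) g₀ pr (verticalBasis (F := F) g₀ pr x a).1 y)) x
          (verticalBasis (F := F) g₀ pr x a) +
        g₀.inner x (horizontalLift (g t) pr x (Q (pr x)) - horizontalLift g₀ pr x (Q (pr x)))
          (leviCivita g₀ (verticalExtend (F := F) g₀ pr (verticalBasis (F := F) g₀ pr x a).1) x
            (verticalBasis (F := F) g₀ pr x a))) := by
  have hX := (hs.contMDiffAt_horizontalLift_field hQ).mdifferentiableAt (n := ∞) (by simp)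
  have hX₀ := (hs₀.contMDiffAt_horizontalLift_field hQ).mdifferentiableAt (n := ∞) (by simp)
  have hsum := hs₀.verticalDiv_eq_sum (X := fun y => horizontalLift (g t) pr y (Q (pr y)) -
    horizontalLift g₀ pr y (Q (pr y))) (mdifferentiableAt_sub_section hX hX₀)
  rw [hs.inner_meanCurvature_horizontalLift hQ,
    hs₀.verticalDiv_horizontalLift hs (hvar.vertical t ht) hQ, hsum, neg_add,
    ← Finset.sum_neg_distrib]
  congr 1
  refine Finset.sum_congr rfl fun a _ => ?_
  set e : TangentSpace 𝓘(ℝ, E) x := (verticalBasis (F := F) g₀ pr x a).1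
  -- The difference of the lifts is vertical, where `g t` and `g₀` agree, and the `g t`-lift is `g
  -- t`-orthogonal to vertical vectors.
  have hfun : (fun y => g₀.inner y
      (horizontalLift (g t) pr y (Q (pr y)) - horizontalLift g₀ pr y (Q (pr y)))
      (verticalExtend (F := F) g₀ pr e y)) =
      -fun y => (g t).inner y (horizontalLift g₀ pr y (Q (pr y)))
        (verticalExtend (F := F) g₀ pr e y) := by
    funext y
    have hv := verticalExtend_mem (F := F) g₀ pr e y
    have hd : horizontalLift (g t) pr y (Q (pr y)) - horizontalLift g₀ pr y (Q (pr y)) ∈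
        verticalSpace (F := F) pr y := by
      rw [mem_verticalSpace, map_sub, hs.mfderiv_horizontalLift, hs.mfderiv_horizontalLift,
        sub_self]
    rw [← hvar.vertical t ht y _ hd _ hv, map_sub, sub_apply,
      inner_horizontal_vertical (horizontalLift_mem _) hv, zero_sub]
    rfl
  rw [hfun, mvfderiv_neg, neg_apply]
  ring

/-- The derivative of the horizontal components of the mean curvature of the fibers. -/
theorem IsVariation.hasDerivAt_inner_meanCurvature (hvar : IsVariation (F := F) pr g₀ ε g)
    (ht : t ∈ Set.Ioo (-ε) ε) (hs₀ : IsRiemannianSubmersion pr g₀ gN)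
    (hs : ∀ t ∈ Set.Ioo (-ε) ε, IsRiemannianSubmersion pr (g t) gN)
    {U : Set N} (hU : IsOpen U) (hxU : x ∈ pr ⁻¹' U)
    (hVs : ∀ i, CMDiff[pr ⁻¹' U] ∞ (T% (V i)))
    (hV : ∀ i, ∀ x ∈ pr ⁻¹' U, V i x ∈ verticalSpace (F := F) pr x)
    (hWs : ∀ i, CMDiff[U] ∞ (T% (W i)))
    (hvel : ∀ x ∈ pr ⁻¹' U, ∀ u ∈ verticalSpace (F := F) pr x, IsVelocitySharp g t x u
      (∑ i, g₀.inner x (V i x) u •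
        horizontalProj (F := F) (g t) pr x (horizontalLift g₀ pr x (W i (pr x)))))
    {Q : Π y : N, TangentSpace 𝓘(ℝ, F) y} (hQ : CMDiffAt ∞ (T% Q) (pr x)) :
    HasDerivAt (fun s => (g s).inner x (meanCurvature (F := F) (g s) pr x)
        (horizontalLift (g s) pr x (Q (pr x))))
      (∑ i, gN.inner (pr x) (W i (pr x)) (Q (pr x)) * verticalDiv (F := F) g₀ pr (V i) x) t := by
  have hUx : pr ⁻¹' U ∈ 𝓝 x := (hU.preimage hs₀.contMDiff.continuous).mem_nhds hxU
  have hVx : ∀ i, MDiffAt (T% (V i)) x := fun i =>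
    ((hVs i).contMDiffAt hUx).mdifferentiableAt (by simp)
  have hc : ∀ i, MDifferentiableAt 𝓘(ℝ, F) 𝓘(ℝ, ℝ) (fun z => gN.inner z (W i z) (Q z)) (pr x) :=
    fun i => (_root_.contMDiffAt_inner gN ((hWs i).contMDiffAt (hU.mem_nhds hxU))
      hQ).mdifferentiableAt (n := ∞) (by simp)
  have hcx : ∀ i, MDifferentiableAt 𝓘(ℝ, E) 𝓘(ℝ, ℝ)
      (fun y => gN.inner (pr y) (W i (pr y)) (Q (pr y))) x := fun i =>
    (hc i).comp x (hs₀.mdifferentiableAt x)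
  -- `-Y` is the velocity of the lift of `Q`. Its coefficients come from the base, so the divergence
  -- of `Y` is the corresponding combination of the divergences of the `V i`.
  let Y : Π x : M, TangentSpace 𝓘(ℝ, E) x :=
    ∑ i, (fun y => gN.inner (pr y) (W i (pr y)) (Q (pr y))) • V i
  have hYapp : ∀ y, Y y = ∑ i, gN.inner (pr y) (W i (pr y)) (Q (pr y)) • V i y := by
    intro y
    simp only [Y, Finset.sum_apply]
    rfl
  obtain ⟨hYd, hYdiv⟩ := verticalDiv_sum (F := F) (g := g₀) (pr := pr) Finset.univ
    (fun i _ => (hcx i).smul_section (hVx i))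
  have hYdiv' : verticalDiv (F := F) g₀ pr Y x =
      ∑ i, gN.inner (pr x) (W i (pr x)) (Q (pr x)) * verticalDiv (F := F) g₀ pr (V i) x := by
    refine hYdiv.trans (Finset.sum_congr rfl fun i _ => ?_)
    exact verticalDiv_smul (hcx i) (hVx i) fun v hv =>
      mvfderiv_comp_of_mem_verticalSpace (hc i) (hs₀.mdifferentiableAt x) hv
  rw [← hYdiv', hs₀.verticalDiv_eq_sum hYd]
  have hlift := hvar.hasDerivAt_horizontalLift ht hs₀ hs (fun i => hV i x hxU) (hvel x hxU)
    (Q (pr x))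
  rw [← hYapp x] at hlift
  have hterm : ∀ a, HasDerivAt (fun s =>
      mvfderiv 𝓘(ℝ, E) (fun y => (g s).inner y (horizontalLift g₀ pr y (Q (pr y)))
          (verticalExtend (F := F) g₀ pr (verticalBasis (F := F) g₀ pr x a).1 y)) x
          (verticalBasis (F := F) g₀ pr x a) +
        g₀.inner x (horizontalLift (g s) pr x (Q (pr x)) - horizontalLift g₀ pr x (Q (pr x)))
          (leviCivita g₀ (verticalExtend (F := F) g₀ pr (verticalBasis (F := F) g₀ pr x a).1) x
            (verticalBasis (F := F) g₀ pr x a)))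
      (mvfderiv 𝓘(ℝ, E) (fun y => g₀.inner y (Y y)
          (verticalExtend (F := F) g₀ pr (verticalBasis (F := F) g₀ pr x a).1 y)) x
          (verticalBasis (F := F) g₀ pr x a) -
        g₀.inner x (Y x) (leviCivita g₀
          (verticalExtend (F := F) g₀ pr (verticalBasis (F := F) g₀ pr x a).1) x
          (verticalBasis (F := F) g₀ pr x a))) t := by
    intro a
    set e : TangentSpace 𝓘(ℝ, E) x := (verticalBasis (F := F) g₀ pr x a).1
    have h1 := hasDerivAt_mvfderiv (f := fun s y => (g s).inner y
      (horizontalLift g₀ pr y (Q (pr y))) (verticalExtend (F := F) g₀ pr e y))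
      (hvar.contMDiffAt_inner ht (hs₀.contMDiffAt_horizontalLift_field hQ)
      (hs₀.contMDiffAt_verticalExtend e)) e
    -- The identity is needed on a neighborhood of `x`, since it is then differentiated along the
    -- fiber.
    have h2 : (fun y => deriv (fun s => (g s).inner y (horizontalLift g₀ pr y (Q (pr y)))
          (verticalExtend (F := F) g₀ pr e y)) t) =ᶠ[𝓝 x]
        fun y => g₀.inner y (Y y) (verticalExtend (F := F) g₀ pr e y) := by
      filter_upwards [hUx] with y hy
      rw [hYapp y]
      exact metricVelocity_horizontalLift hs₀ (hs t ht)
        (hvel y hy _ (verticalExtend_mem g₀ pr e y)) (Q (pr y))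
    rw [h2.mvfderiv_eq] at h1
    set n : TangentSpace 𝓘(ℝ, E) x := leviCivita g₀ (verticalExtend (F := F) g₀ pr e) x e
    -- At fixed `x` the lifts form a curve in one vector space, so the second term is a fixed linear
    -- functional along that curve.
    let L : E →L[ℝ] ℝ := g₀.inner x n
    have h3 : HasDerivAt (fun s => L (horizontalLift (g s) pr x (Q (pr x)))) (L (-(Y x))) t :=
      L.hasFDerivAt.comp_hasDerivAt t hlift
    have h4 : HasDerivAt (fun s => g₀.inner x (horizontalLift (g s) pr x (Q (pr x)) -
        horizontalLift g₀ pr x (Q (pr x))) n) (-g₀.inner x (Y x) n) t := by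
      have h5 := h3.sub_const (L (horizontalLift g₀ pr x (Q (pr x))))
      have h6 : L (-(Y x)) = -g₀.inner x (Y x) n := by
        rw [g₀.symm x (Y x) n]
        exact map_neg (g₀.inner x n) (Y x)
      rw [h6] at h5
      refine h5.congr_of_eventuallyEq (Filter.Eventually.of_forall fun s => ?_)
      change g₀.inner x _ n = g₀.inner x n _ - g₀.inner x n _
      rw [g₀.symm x _ n, map_sub]
    exact h1.add h4
  have hsum := (HasDerivAt.fun_sum (u := Finset.univ) fun a _ => hterm a).const_add
    (-verticalDiv (F := F) g₀ pr (fun y => horizontalLift g₀ pr y (Q (pr y))) x)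
  refine hsum.congr_of_eventuallyEq ?_
  filter_upwards [isOpen_Ioo.mem_nhds ht] with s hs'
  exact hvar.inner_meanCurvature_eq hs' hs₀ (hs s hs') hQ

/-- $H$ is the lift of its own projection, which is expanded on `N`. The basis there does not depend
on `g`, so along a variation only the coefficients and the lifts move. -/
theorem IsRiemannianSubmersion.meanCurvature_eq_sum {g : SmoothMetric E M}
    (hs : IsRiemannianSubmersion pr g gN) (hQ : (∀ u v, metricForm gN (pr x) u v =
      metricForm gN (pr x) v u) ∧ ∀ v, v ≠ 0 → 0 < metricForm gN (pr x) v v) :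
    meanCurvature (F := F) g pr x = ∑ j, g.inner x (meanCurvature (F := F) g pr x)
        (horizontalLift g pr x (formOrthonormalBasis (metricForm gN (pr x)) hQ j)) •
      horizontalLift g pr x (formOrthonormalBasis (metricForm gN (pr x)) hQ j) := by
  have h := sum_inner_formOrthonormalBasis gN hQ
    (mfderiv 𝓘(ℝ, E) 𝓘(ℝ, F) pr x (meanCurvature (F := F) g pr x))
  conv_lhs => rw [← horizontalProj_of_mem (meanCurvature_mem (F := F) g pr x),
    ← hs.horizontalLift_mfderiv, ← h, hs.horizontalLift_sum_smul]
  refine Finset.sum_congr rfl fun j _ => ?_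
  rw [g.symm x, hs.inner_horizontalLift, gN.symm]

/-- The derivative of the mean curvature of the fibers along a variation by submersion metrics. -/
theorem IsVariation.exists_hasDerivAt_meanCurvature (hvar : IsVariation (F := F) pr g₀ ε g)
    (ht : t ∈ Set.Ioo (-ε) ε) (hs₀ : IsRiemannianSubmersion pr g₀ gN)
    (hs : ∀ t ∈ Set.Ioo (-ε) ε, IsRiemannianSubmersion pr (g t) gN)
    {U : Set N} (hU : IsOpen U) (hxU : x ∈ pr ⁻¹' U)
    (hVs : ∀ i, CMDiff[pr ⁻¹' U] ∞ (T% (V i)))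
    (hV : ∀ i, ∀ x ∈ pr ⁻¹' U, V i x ∈ verticalSpace (F := F) pr x)
    (hWs : ∀ i, CMDiff[U] ∞ (T% (W i)))
    (hvel : ∀ x ∈ pr ⁻¹' U, ∀ u ∈ verticalSpace (F := F) pr x, IsVelocitySharp g t x u
      (∑ i, g₀.inner x (V i x) u •
        horizontalProj (F := F) (g t) pr x (horizontalLift g₀ pr x (W i (pr x))))) :
    ∃ D : TangentSpace 𝓘(ℝ, E) x,
      HasDerivAt (fun s => meanCurvature (F := F) (g s) pr x) D t ∧
      horizontalProj (F := F) (g t) pr x D =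
        ∑ i, verticalDiv (F := F) g₀ pr (V i) x •
          horizontalProj (F := F) (g t) pr x (horizontalLift g₀ pr x (W i (pr x))) := by
  have hB : (∀ u v, metricForm gN (pr x) u v = metricForm gN (pr x) v u) ∧
      ∀ v, v ≠ 0 → 0 < metricForm gN (pr x) v v :=
    ⟨fun u v => gN.symm (pr x) u v, fun v hv => gN.pos (pr x) v hv⟩
  set q := formOrthonormalBasis (metricForm gN (pr x)) hB with hq
  have hcoef : ∀ j, HasDerivAt (fun s => (g s).inner x (meanCurvature (F := F) (g s) pr x)
        (horizontalLift (g s) pr x (q j)))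
      (∑ i, gN.inner (pr x) (W i (pr x)) (q j) * verticalDiv (F := F) g₀ pr (V i) x) t := by
    intro j
    have h := hvar.hasDerivAt_inner_meanCurvature ht hs₀ hs hU hxU hVs hV hWs hvel
      (FiberBundle.contMDiffAt_extend 𝓘(ℝ, F) F (V := (TangentSpace 𝓘(ℝ, F) : N → Type _)) (q j))
    simpa only [FiberBundle.extend_apply_self] using h
  let Y : Fin (Module.finrank ℝ (TangentSpace 𝓘(ℝ, F) (pr x))) → TangentSpace 𝓘(ℝ, E) x :=
    fun j => ∑ i, gN.inner (pr x) (W i (pr x)) (q j) • V i x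
  have hY : ∀ j, Y j ∈ verticalSpace (F := F) pr x := fun j =>
    Submodule.sum_mem _ fun i _ => Submodule.smul_mem _ _ (hV i x hxU)
  have hlift : ∀ j, HasDerivAt (F := E) (fun s => horizontalLift (g s) pr x (q j)) (-Y j) t :=
    fun j => hvar.hasDerivAt_horizontalLift ht hs₀ hs (fun i => hV i x hxU) (hvel x hxU) (q j)
  let c : ℝ → Fin (Module.finrank ℝ (TangentSpace 𝓘(ℝ, F) (pr x))) → ℝ := fun s j =>
    (g s).inner x (meanCurvature (F := F) (g s) pr x) (horizontalLift (g s) pr x (q j))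
  -- Product rule in the expansion of $H_s$: coefficient times velocity of the lift, plus velocity
  -- of the coefficient times lift.
  refine ⟨∑ j, (c t j • -Y j +
    (∑ i, gN.inner (pr x) (W i (pr x)) (q j) * verticalDiv (F := F) g₀ pr (V i) x) •
      horizontalLift (g t) pr x (q j)), ?_, ?_⟩
  · have h1 := HasDerivAt.fun_sum (F := E) (u := Finset.univ) fun j _ => (hcoef j).smul (hlift j)
    refine h1.congr_of_eventuallyEq ?_
    filter_upwards [isOpen_Ioo.mem_nhds ht] with s hs'
    exact (hs s hs').meanCurvature_eq_sum hB
  · have hst := hs t ht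
    -- The velocities of the lifts are vertical, so only the derivatives of the coefficients survive
    -- the projection.
    have h1 : ∀ j, horizontalProj (F := F) (g t) pr x (Y j) = 0 := fun j =>
      horizontalProj_of_mem_vertical (hY j)
    have h2 : ∀ j, horizontalProj (F := F) (g t) pr x (horizontalLift (g t) pr x (q j)) =
        horizontalLift (g t) pr x (q j) := fun j =>
      horizontalProj_of_mem (horizontalLift_mem (q j))
    simp only [map_sum, map_add, map_smul, map_neg, h1, h2, neg_zero, smul_zero, zero_add,
      ← hst.horizontalLift_eq g₀, Finset.sum_smul]
    rw [Finset.sum_comm]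
    refine Finset.sum_congr rfl fun i _ => ?_
    -- The sum over `j` reassembles each `W i` from its components in the orthonormal basis.
    conv_rhs => rw [← sum_inner_formOrthonormalBasis gN hB (W i (pr x)),
      hst.horizontalLift_sum_smul, Finset.smul_sum]
    refine Finset.sum_congr rfl fun j _ => ?_
    rw [smul_smul, mul_comm]

end Velocity

end MeanCurvatureVariation

end

theorem theorem3p13
    {E : Type*} [NormedAddCommGroup E] [NormedSpace ℝ E] [FiniteDimensional ℝ E]
    {M : Type*} [TopologicalSpace M] [T2Space M] [SecondCountableTopology M]
    [ChartedSpace E M] [IsManifold 𝓘(ℝ, E) ∞ M]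
    {F : Type*} [NormedAddCommGroup F] [NormedSpace ℝ F] [FiniteDimensional ℝ F]
    {N : Type*} [TopologicalSpace N] [T2Space N] [SecondCountableTopology N]
    [ChartedSpace F N] [IsManifold 𝓘(ℝ, F) ∞ N]
    (pr : M → N) (g₀ : SmoothMetric E M) (gN : SmoothMetric F N)
    (hpr : IsRiemannianSubmersion pr g₀ gN) :
    -- a non-trivial variation keeping the submersion and minimality gives a divergence-free field
    (HasMinimalFibers (F := F) g₀ pr →
      (∃ (ε : ℝ) (g : ℝ → SmoothMetric E M), IsVariation (F := F) pr g₀ ε g ∧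
        (∃ t ∈ Set.Ioo (-ε) ε, g t ≠ g₀) ∧
        ∀ t ∈ Set.Ioo (-ε) ε,
          IsRiemannianSubmersion pr (g t) gN ∧ HasMinimalFibers (F := F) (g t) pr) →
      ∃ ξ : Π x : M, TangentSpace 𝓘(ℝ, E) x, CMDiff ∞ (T% ξ) ∧
        (∀ x, ξ x ∈ verticalSpace (F := F) pr x) ∧ (∃ x, ξ x ≠ 0) ∧
        ∀ x, verticalDiv (F := F) g₀ pr ξ x = 0) ∧
    -- a bounded non-trivial divergence-free field gives such a variation
    (HasMinimalFibers (F := F) g₀ pr → 0 < Module.finrank ℝ F →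
      (∃ ξ : Π x : M, TangentSpace 𝓘(ℝ, E) x, CMDiff ∞ (T% ξ) ∧
        (∀ x, ξ x ∈ verticalSpace (F := F) pr x) ∧ (∃ x, ξ x ≠ 0) ∧
        (∃ C : ℝ, ∀ x, g₀.inner x (ξ x) (ξ x) ≤ C) ∧
        ∀ x, verticalDiv (F := F) g₀ pr ξ x = 0) →
      ∃ (ε : ℝ) (g : ℝ → SmoothMetric E M), IsVariation (F := F) pr g₀ ε g ∧
        (∃ t ∈ Set.Ioo (-ε) ε, g t ≠ g₀) ∧
        ∀ t ∈ Set.Ioo (-ε) ε,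
          IsRiemannianSubmersion pr (g t) gN ∧ HasMinimalFibers (F := F) (g t) pr) ∧
    -- the formula for the derivative of the mean curvature of the fibers
    (∀ (ε : ℝ) (g : ℝ → SmoothMetric E M), IsVariation (F := F) pr g₀ ε g →
      (∀ t ∈ Set.Ioo (-ε) ε, IsRiemannianSubmersion pr (g t) gN) →
      ∀ t ∈ Set.Ioo (-ε) ε, ∀ (U : Set N), IsOpen U →
      ∀ (k : ℕ) (V : Fin k → Π x : M, TangentSpace 𝓘(ℝ, E) x)
        (W : Fin k → Π y : N, TangentSpace 𝓘(ℝ, F) y),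
        (∀ i, CMDiff[pr ⁻¹' U] ∞ (T% (V i))) →
        (∀ i, ∀ x ∈ pr ⁻¹' U, V i x ∈ verticalSpace (F := F) pr x) →
        (∀ i, CMDiff[U] ∞ (T% (W i))) →
        (∀ x ∈ pr ⁻¹' U, ∀ u ∈ verticalSpace (F := F) pr x,
          IsVelocitySharp g t x u
            (∑ i, g₀.inner x (V i x) u •
              horizontalProj (F := F) (g t) pr x (horizontalLift g₀ pr x (W i (pr x))))) →
        ∀ x ∈ pr ⁻¹' U, ∃ D : TangentSpace 𝓘(ℝ, E) x,
          HasDerivAt (fun s => meanCurvature (F := F) (g s) pr x) D t ∧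
          horizontalProj (F := F) (g t) pr x D =
            ∑ i, verticalDiv (F := F) g₀ pr (V i) x •
              horizontalProj (F := F) (g t) pr x (horizontalLift g₀ pr x (W i (pr x)))) := by
  -- The first part compares `g₀` with a single metric `g t` that differs from it.
  refine ⟨fun hmin ⟨_, _, hvar, ⟨t, ht, hne⟩, hall⟩ => hpr.exists_divergenceFree (hall t ht).1
      (hvar.vertical t ht) hmin (hall t ht).2 hne,
    fun hmin hF ⟨_, hξ, hξV, ⟨_, hx⟩, _, hdiv⟩ => hpr.exists_variation hmin hF hξ hξV hx hdiv,
    fun _ _ hvar hs _ ht _ hU _ _ _ hVs hV hWs hvel _ hx =>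
      hvar.exists_hasDerivAt_meanCurvature ht hpr hs hU hx hVs hV hWs hvel⟩
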